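/- **Setting.** Consider $N$ qubits and a random circuit $\mathbf U=B_M\cdots B_2B_1$ (with $B_1$ acting first), where the block $B_k$ acts on a set $s(B_k)$ of qubits (of arbitrary shape and size) and as the identity elsewhere. The blocks are independent random unitaries, and the law of each $B_k$ is a unitary $2$-design on its support, i.e. its moments of degree $2$ in the matrix entries and degree $2$ in their conjugates agree with those of the Haar measure on $\mathrm U(2^{|s(B_k)|})$. Let $H=\sum_j\lambda_jh_j$ be a traceless Hamiltonian, with pairwise distinct Pauli strings $h_j$ and real coefficients $\lambda_j$. Write $s(O)$ for the set of qubits on which an operator $O$ acts non-trivially, and assume $s(\mathbf U):=\bigcup_k s(B_k)\supseteq s(H)$. The cost is $C=\langle \mathbf 0|\mathbf U^\dagger H\mathbf U|\mathbf 0\rangle$. **Connections.** For $k<k'$ the connecting support is $s_c(B_k,B_{k'})=\big(s(B_k)\cap s(B_{k'})\big)\setminus\bigcup_{k<k''<k'}s(B_{k''})$. The forward residual support is $s_f(B_k)=s(B_k)\setminus\bigcup_{k'<k}s(B_{k'})$, and for the initial state $\rho_0=|\mathbf 0\rangle\langle\mathbf 0|$ we put $s_c(\rho_0,B_k)=s_f(B_k)$.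 The connecting support of $B_k$ and a Pauli string $h_j$ is $\big(s(B_k)\cap s(h_j)\big)\setminus\bigcup_{k'>k}s(B_{k'})$. Two objects are connected if their connecting support is non-empty. **Paths and path sets.** A path with respect to $h_j$ is a non-empty sequence of blocks $B_{k_1},\dots,B_{k_m}$ with $k_1<\dots<k_m$ such that $\rho_0$ is connected to $B_{k_1}$, consecutive blocks are connected, and the right end $B_{k_m}$ is connected to $h_j$. Its edges are $(\rho_0,B_{k_1}),(B_{k_1},B_{k_2}),\dots,(B_{k_{m-1}},B_{k_m})$. A path set $P_j$ covering $h_j$ is a set of paths with respect to $h_j$ such that every qubit of $s(h_j)$ lies in the connecting support of $h_j$ and the right end of some path in $P_j$, and such that any two paths in $P_j$ that share a block $B_k$ coincide from $B_k$ back to $\rho_0$ (in the backward direction paths may merge but not split). Let $\mathrm{Edge}(P_j)$ be the set of all edges of paths in $P_j$ (an edge common to several paths is counted once), and let $\mathrm{Head}(P_j)$ be the set of blocks $B_k$ with $(\rho_0,B_k)\in\mathrm{Edge}(P_j)$. The length and the head width of $P_j$ are $$l(P_j)=\sum_{(a,B_k)\in\mathrm{Edge}(P_j)}\log_4\frac{4^{|s(B_k)|}-1}{4^{|s_c(a,B_k)|}-1},\qquad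 w(P_j)=\sum_{B_k\in\mathrm{Head}(P_j)}\log_2\frac{4^{|s_f(B_k)|}-1}{2^{|s_f(B_k)|}-1}.$$ **Theorem.** Under these assumptions, $$\mathrm{Var}[C]\;\ge\;\sum_j\sum_{P_j}\lambda_j^2\,2^{-2l(P_j)-w(P_j)},$$ where $P_j$ runs over all path sets covering $h_j$. -/

import Mathlib

open MeasureTheory ProbabilityTheory

/-! Qubit operators are complex matrices indexed by computational basis states
`Fin N → Fin 2`.  A block acting on the qubits in `s` is a unitary matrix indexed by
`s → Fin 2`. -/

/-- The four single-qubit Pauli operators (with the identity). -/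
inductive Pauli where
  | I | X | Y | Z

/-- The `2 × 2` matrix of a single-qubit Pauli operator. -/
def Pauli.toMatrix : Pauli → Matrix (Fin 2) (Fin 2) ℂ
  | .I => 1
  | .X => !![0, 1; 1, 0]
  | .Y => !![0, -Complex.I; Complex.I, 0]
  | .Z => !![1, 0; 0, -1]

/-- The operator of an `N`-qubit Pauli string, i.e. the tensor product
`σ 0 ⊗ σ 1 ⊗ ⋯ ⊗ σ (N-1)`. -/
def pauliOp {N : ℕ} (σ : Fin N → Pauli) : Matrix (Fin N → Fin 2) (Fin N → Fin 2) ℂ :=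
  Matrix.of fun x y => ∏ q, (σ q).toMatrix (x q) (y q)

/-- `liftOp s A` is the `N`-qubit operator that acts as `A` on the qubits in `s` and as the
identity on all other qubits. -/
def liftOp {N : ℕ} (s : Finset (Fin N)) (A : Matrix (s → Fin 2) (s → Fin 2) ℂ) :
    Matrix (Fin N → Fin 2) (Fin N → Fin 2) ℂ :=
  Matrix.of fun x y => if ∀ q, q ∉ s → x q = y q then A (fun q => x q) (fun q => y q) else 0

open Classical in
/-- The support `s(O)` of an operator: the qubits on which `O` acts non-trivially.
A qubit `q` is outside the support iff `O` is the identity on `q` tensored with an operator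
on the other qubits. -/
noncomputable def opSupport {N : ℕ} (O : Matrix (Fin N → Fin 2) (Fin N → Fin 2) ℂ) :
    Finset (Fin N) :=
  Finset.univ.filter fun q => O ∉ Set.range (liftOp (Finset.univ.erase q))

section Haar

variable {n : Type*} [Fintype n] [DecidableEq n]

noncomputable instance unitaryMeasurableSpace : MeasurableSpace (Matrix.unitaryGroup n ℂ) := borel _

instance unitaryBorelSpace : BorelSpace (Matrix.unitaryGroup n ℂ) := ⟨rfl⟩

instance unitaryCompactSpace : CompactSpace (Matrix.unitaryGroup n ℂ) := by
  refine (isCompact_iff_compactSpace (s := ((Matrix.unitaryGroup n ℂ : Submonoid _) :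
    Set (Matrix n n ℂ)))).mp ?_
  have hK : IsCompact (Set.univ.pi fun _ : n => Set.univ.pi fun _ : n =>
      Metric.closedBall (0 : ℂ) 1) :=
    isCompact_univ_pi fun _ => isCompact_univ_pi fun _ => isCompact_closedBall _ _
  refine IsCompact.of_isClosed_subset (X := n → n → ℂ) hK ?_ ?_
  · exact isClosed_unitary (R := Matrix n n ℂ)
  · intro U hU i _ j _
    simpa using entry_norm_bound_of_unitary (𝕜 := ℂ) (n := n) (U := U) hU i j

end Haar

/-- The Haar probability measure on the unitary group. -/
noncomputable def unitaryHaar (n : Type*) [Fintype n] [DecidableEq n] :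
    Measure (Matrix.unitaryGroup n ℂ) :=
  Measure.haarMeasure ⊤

/-- A measure on the unitary group is a `2`-design if all its moments of degree `2` in the matrix
entries and degree `2` in their complex conjugates agree with those of the Haar measure. -/
def IsTwoDesign {n : Type*} [Fintype n] [DecidableEq n]
    (ν : Measure (Matrix.unitaryGroup n ℂ)) : Prop :=
  ∀ i₁ j₁ i₂ j₂ i₃ j₃ i₄ j₄ : n,
    ∫ U, U.1 i₁ j₁ * U.1 i₂ j₂ * star (U.1 i₃ j₃) * star (U.1 i₄ j₄) ∂ν =
      ∫ U, U.1 i₁ j₁ * U.1 i₂ j₂ * star (U.1 i₃ j₃) * star (U.1 i₄ j₄) ∂(unitaryHaar n)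

/-- The circuit unitary `B (M-1) * ⋯ * B 1 * B 0`: block `0` acts first on the state. -/
def circuitUnitary {N M : ℕ} (s : Fin M → Finset (Fin N))
    (B : (k : Fin M) → Matrix.unitaryGroup (s k → Fin 2) ℂ) :
    Matrix (Fin N → Fin 2) (Fin N → Fin 2) ℂ :=
  (List.ofFn fun k => liftOp (s k) (B k).1).reverse.prod

/-- The cost `⟨0|U† H U|0⟩`, where `|0⟩` is the all-zero basis state
(for Hermitian `H` this number is real). -/
def energyCost {N : ℕ} (H U : Matrix (Fin N → Fin 2) (Fin N → Fin 2) ℂ) : ℝ :=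
  let ψ : (Fin N → Fin 2) → ℂ := U.mulVec (Pi.single 0 1)
  (dotProduct (star ψ) (H.mulVec ψ)).re

/-! ### Paths and path sets

Only the supports `s k` of the blocks enter.  The initial state `ρ₀` is represented by the element
`⊥ : WithBot (Fin M)`, which precedes every block. -/

section Paths

variable {N M : ℕ}

/-- The forward residual support `s_f(B_k) = s(B_k) - ⋃_{k' < k} s(B_{k'})`. -/
def forwardResidual (s : Fin M → Finset (Fin N)) (k : Fin M) : Finset (Fin N) :=
  s k \ (Finset.Iio k).biUnion s

/-- The connecting support `s_c(a, B_k)`: for a block `a = B_{k'}` it is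
`s(B_{k'}) ∩ s(B_k) - ⋃_{k' < k'' < k} s(B_{k''})`; for the initial state, which acts on
all qubits before every block, it is the forward residual support. -/
def connSupport (s : Fin M → Finset (Fin N)) : WithBot (Fin M) → Fin M → Finset (Fin N)
  | none, k => forwardResidual s k
  | some k', k => (s k' ∩ s k) \ (Finset.Ioo k' k).biUnion s

/-- The connecting support of `B_k` and an observable with support `A`, which is measured after
all blocks. -/
def obsConnSupport (s : Fin M → Finset (Fin N)) (A : Finset (Fin N)) (k : Fin M) :
    Finset (Fin N) :=
  (s k ∩ A) \ (Finset.Ioi k).biUnion s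

/-- A time-ordered sequence of blocks `k₁ < k₂ < ⋯` is the same as a finite set of block indices.
`prevIn p k` is the element of `p` just before `k`, and `⊥` (the initial state) if `k` is the
first one. -/
def prevIn (p : Finset (Fin M)) (k : Fin M) : WithBot (Fin M) :=
  (p.filter (· < k)).max

/-- The edges of a path `k₁ < k₂ < ⋯`, namely `(ρ₀, k₁), (k₁, k₂), ⋯`. -/
def pathEdges (p : Finset (Fin M)) : Finset (WithBot (Fin M) × Fin M) :=
  p.image fun k => (prevIn p k, k)

/-- `t` is the right end (the last block) of `p`. -/
def IsRightEnd (p : Finset (Fin M)) (t : Fin M) : Prop :=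
  t ∈ p ∧ ∀ k ∈ p, k ≤ t

/-- A path with respect to an observable with support `A`: a sequence of blocks that starts at the
initial state, passes between connected blocks, and ends at a block connected to the
observable. -/
def IsPath (s : Fin M → Finset (Fin N)) (A : Finset (Fin N)) (p : Finset (Fin M)) : Prop :=
  (∀ e ∈ pathEdges p, (connSupport s e.1 e.2).Nonempty) ∧
    ∃ t, IsRightEnd p t ∧ (obsConnSupport s A t).Nonempty

/-- A path set with respect to an observable with support `A`: a collection of paths whose right
ends cover `A` by their connections to the observable, and such that two paths that share a block
coincide from there back to the initial state (paths may merge but not split in the backward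
direction). -/
def IsPathSet (s : Fin M → Finset (Fin N)) (A : Finset (Fin N))
    (P : Finset (Finset (Fin M))) : Prop :=
  (∀ p ∈ P, IsPath s A p) ∧
  (∀ q ∈ A, ∃ p ∈ P, ∃ t, IsRightEnd p t ∧ q ∈ obsConnSupport s A t) ∧
  (∀ p ∈ P, ∀ p' ∈ P, ∀ k, k ∈ p → k ∈ p' → p.filter (· ≤ k) = p'.filter (· ≤ k))

open Classical in
/-- All path sets covering an observable with support `A`. -/
noncomputable def pathSets (s : Fin M → Finset (Fin N)) (A : Finset (Fin N)) :
    Finset (Finset (Finset (Fin M))) :=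
  Finset.univ.filter (IsPathSet s A)

/-- The set of edges of a path set (an edge shared by several paths occurs once). -/
def pathSetEdges (P : Finset (Finset (Fin M))) : Finset (WithBot (Fin M) × Fin M) :=
  P.biUnion pathEdges

/-- The head blocks of a path set: those connected directly to the initial state by an edge. -/
def headBlocks (P : Finset (Finset (Fin M))) : Finset (Fin M) :=
  Finset.univ.filter fun k => (⊥, k) ∈ pathSetEdges P

/-- The length `log₄ [(4^|s(B_k)| - 1) / (4^|s_c(a, B_k)| - 1)]` of an edge `(a, B_k)`. -/
noncomputable def edgeLength (s : Fin M → Finset (Fin N)) (e : WithBot (Fin M) × Fin M) : ℝ :=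
  Real.logb 4 (((4 : ℝ) ^ (s e.2).card - 1) / ((4 : ℝ) ^ (connSupport s e.1 e.2).card - 1))

/-- The length `l(P)` of a path set. -/
noncomputable def pathSetLength (s : Fin M → Finset (Fin N)) (P : Finset (Finset (Fin M))) : ℝ :=
  ∑ e ∈ pathSetEdges P, edgeLength s e

/-- The width `w(B_k) = log₂ [(4^|s_f(B_k)| - 1) / (2^|s_f(B_k)| - 1)]` of a block. -/
noncomputable def blockWidth (s : Fin M → Finset (Fin N)) (k : Fin M) : ℝ :=
  Real.logb 2 (((4 : ℝ) ^ (forwardResidual s k).card - 1) /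
    ((2 : ℝ) ^ (forwardResidual s k).card - 1))

/-- The head width `w(P)` of a path set. -/
noncomputable def headWidth (s : Fin M → Finset (Fin N)) (P : Finset (Finset (Fin M))) : ℝ :=
  ∑ k ∈ headBlocks P, blockWidth s k

end Paths

/-!
The variance is computed in the Heisenberg picture, in the basis of Pauli strings. A single random
block acts on a Pauli string in a simple way (`integral_pauliCoeff_mul_pauliCoeff`): to second
order, a `2`-design fixes the identity, sends a non-identity string on its support to each of the
`4 ^ m - 1` non-identity strings with equal probability, and leaves distinct strings uncorrelated.
For the Haar measure this needs no Weingarten calculus. Left multiplication by a suitable Pauli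
string changes the sign of the second moment of two distinct strings, so it vanishes. Left
multiplication by `(P + R) / √2` exchanges two anticommuting strings `P` and `R`, so all
non-identity strings have the same second moment. The common value follows from the identity
`∑ σ, σ ⊗ σ = 2 ^ m • SWAP`, whose right-hand side commutes with `U ⊗ U`.

Going backward through independent blocks, the second moment of a Pauli expectation is therefore the
probability that a random walk on Pauli strings ends in a product of `I`s and `Z`s, which are the
strings with non-zero expectation in `|0⟩`; this is `trajectorySum`, a sum over the families of
strings left behind by the blocks. Cross terms vanish because two distinct strings with non-zero
coefficients differ on a qubit of some block, and the mean vanishes because it is a cross term with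
the identity string. This gives the exact value of the variance in `variance_energyCost`.

A path set `P` selects the trajectories in which block `k` leaves the identity if it is on no path,
and otherwise a non-identity string supported inside the connection of `k` to its predecessor on the
paths, made of `Z`s if the predecessor is the initial state (`compatibleStrings`). Such a string
meets no block before the predecessor, so the active blocks of the trajectory are exactly the blocks
of `P` (`isPauliTrajectory_of_compatible`). Counting strings shows that the total weight of these
trajectories is at least the weight of `P` (`rpow_le_sum_compatible`). The trajectories of different
path sets are different: the support of the string left by a block determines its predecessor, and
the right ends of paths are the last blocks on the qubits of the observable
(`subset_of_compatible`). Hence the sum over path sets is a lower bound for the sum over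
trajectories.
-/

/-! ### Pauli strings on an arbitrary finite set of qubits -/

namespace PauliPath

instance : DecidableEq Pauli := fun a b => by
  cases a <;> cases b <;> first | exact isTrue rfl | exact isFalse (by nofun)

instance : Fintype Pauli := ⟨{.I, .X, .Y, .Z}, fun p => by cases p <;> decide⟩

section Algebra

variable {α : Type*}

/-- The identity Pauli string. -/
def idString : α → Pauli := fun _ => .I

lemma exists_ne_of_ne_idString {P : α → Pauli} (hP : P ≠ idString) : ∃ q, P q ≠ .I :=
  Function.ne_iff.mp hP

variable [Fintype α]

/-- The tensor product of single-qubit matrices. -/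
def tensorOp (A : α → Matrix (Fin 2) (Fin 2) ℂ) : Matrix (α → Fin 2) (α → Fin 2) ℂ :=
  Matrix.of fun x y => ∏ q, A q (x q) (y q)

/-- The operator of a Pauli string on the qubits `α`; for `α = Fin N` this is `pauliOp`. -/
def pauliMat (σ : α → Pauli) : Matrix (α → Fin 2) (α → Fin 2) ℂ :=
  tensorOp fun q => (σ q).toMatrix

variable [DecidableEq α]

lemma tensorOp_mul (A B : α → Matrix (Fin 2) (Fin 2) ℂ) :
    tensorOp A * tensorOp B = tensorOp fun q => A q * B q := by
  ext x y
  simp only [tensorOp, Matrix.mul_apply, Matrix.of_apply, Finset.prod_univ_sum,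
    Fintype.piFinset_univ, Finset.prod_mul_distrib]

omit [DecidableEq α] in
lemma tensorOp_one : tensorOp (fun _ : α => (1 : Matrix (Fin 2) (Fin 2) ℂ)) = 1 := by
  ext x y
  simp only [tensorOp, Matrix.of_apply, Matrix.one_apply]
  split_ifs with hxy
  · simp [hxy]
  · obtain ⟨q, hq⟩ := Function.ne_iff.mp hxy
    exact Finset.prod_eq_zero (Finset.mem_univ q) (by simp [hq])

omit [DecidableEq α] in
lemma tensorOp_smul (c : α → ℂ) (A : α → Matrix (Fin 2) (Fin 2) ℂ) :
    tensorOp (fun q => c q • A q) = (∏ q, c q) • tensorOp A := by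
  ext x y
  simp [tensorOp, Finset.prod_mul_distrib]

lemma trace_tensorOp (A : α → Matrix (Fin 2) (Fin 2) ℂ) :
    (tensorOp A).trace = ∏ q, (A q).trace := by
  simp only [tensorOp, Matrix.trace, Matrix.diag, Matrix.of_apply, Finset.prod_univ_sum,
    Fintype.piFinset_univ]

lemma toMatrix_mul_self (p : Pauli) : p.toMatrix * p.toMatrix = 1 := by
  cases p <;> ext i j <;> fin_cases i <;> fin_cases j <;>
    simp [Pauli.toMatrix, Matrix.mul_apply, Fin.sum_univ_two]

lemma conjTranspose_toMatrix (p : Pauli) : p.toMatrix.conjTranspose = p.toMatrix := by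
  cases p <;> ext i j <;> fin_cases i <;> fin_cases j <;>
    simp [Pauli.toMatrix, Matrix.conjTranspose_apply]

lemma trace_toMatrix_mul (p r : Pauli) :
    (p.toMatrix * r.toMatrix).trace = if p = r then 2 else 0 := by
  cases p <;> cases r <;>
    simp [Pauli.toMatrix, Matrix.trace, Fin.sum_univ_two, one_add_one_eq_two]

lemma sum_toMatrix_mul_toMatrix (x y z w : Fin 2) :
    ∑ p : Pauli, p.toMatrix x y * p.toMatrix z w = if x = w ∧ y = z then 2 else 0 := by
  have hu : (Finset.univ : Finset Pauli) = {.I, .X, .Y, .Z} := rfl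
  rw [hu]
  fin_cases x <;> fin_cases y <;> fin_cases z <;> fin_cases w <;>
    simp [Pauli.toMatrix, one_add_one_eq_two]

/-- The sign in `p r = ± r p` for single-qubit Paulis. -/
def commSign (p r : Pauli) : ℂ := if p = .I ∨ r = .I ∨ p = r then 1 else -1

lemma toMatrix_mul_comm_sign (p r : Pauli) :
    p.toMatrix * r.toMatrix = commSign p r • (r.toMatrix * p.toMatrix) := by
  cases p <;> cases r <;> ext i j <;> fin_cases i <;> fin_cases j <;>
    simp [Pauli.toMatrix, Matrix.mul_apply, Fin.sum_univ_two, commSign]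

lemma pauliMat_mul_self (σ : α → Pauli) : pauliMat σ * pauliMat σ = 1 := by
  simp only [pauliMat, tensorOp_mul, toMatrix_mul_self, tensorOp_one]

omit [DecidableEq α] in
lemma pauliMat_idString : pauliMat (idString : α → Pauli) = 1 := tensorOp_one

omit [DecidableEq α] in
lemma conjTranspose_pauliMat (σ : α → Pauli) : (pauliMat σ).conjTranspose = pauliMat σ := by
  ext x y
  simp only [pauliMat, tensorOp, Matrix.conjTranspose_apply, Matrix.of_apply, star_prod]
  refine Finset.prod_congr rfl fun q _ => ?_
  conv_rhs => rw [← conjTranspose_toMatrix]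
  rfl

lemma trace_pauliMat_mul (σ τ : α → Pauli) :
    (pauliMat σ * pauliMat τ).trace = if σ = τ then 2 ^ Fintype.card α else 0 := by
  simp only [pauliMat, tensorOp_mul, trace_tensorOp, trace_toMatrix_mul]
  split_ifs with h
  · simp [h]
  · obtain ⟨q, hq⟩ := Function.ne_iff.mp h
    exact Finset.prod_eq_zero (Finset.mem_univ q) (by simp [hq])

lemma trace_pauliMat (σ : α → Pauli) :
    (pauliMat σ).trace = if σ = idString then 2 ^ Fintype.card α else 0 := by
  rw [← trace_pauliMat_mul, pauliMat_idString, mul_one]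

/-- Completeness of the Pauli basis: `∑ σ, σ ⊗ σ` is `2 ^ |α|` times the swap operator. -/
lemma sum_pauliMat_mul_pauliMat (x y z w : α → Fin 2) :
    ∑ σ : α → Pauli, pauliMat σ x y * pauliMat σ z w =
      if x = w ∧ y = z then 2 ^ Fintype.card α else 0 := by
  have h1 : ∑ σ : α → Pauli, pauliMat σ x y * pauliMat σ z w =
      ∏ q, ∑ p : Pauli, p.toMatrix (x q) (y q) * p.toMatrix (z q) (w q) := by
    simp only [Finset.prod_univ_sum, Fintype.piFinset_univ, Finset.prod_mul_distrib]
    rfl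
  rw [h1]
  simp only [sum_toMatrix_mul_toMatrix]
  split_ifs with h
  · simp [h.1, h.2]
  · have : ∃ q, ¬ (x q = w q ∧ y q = z q) := by
      by_contra! hc
      exact h ⟨funext fun q => (hc q).1, funext fun q => (hc q).2⟩
    obtain ⟨q, hq⟩ := this
    exact Finset.prod_eq_zero (Finset.mem_univ q) (by rw [if_neg hq])

lemma sum_trace_mul_trace (A B : Matrix (α → Fin 2) (α → Fin 2) ℂ) :
    ∑ σ : α → Pauli, (pauliMat σ * A).trace * (pauliMat σ * B).trace =
      2 ^ Fintype.card α * (A * B).trace := by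
  have h1 : ∀ σ : α → Pauli, (pauliMat σ * A).trace * (pauliMat σ * B).trace =
      ∑ x, ∑ y, ∑ z, ∑ w, A y x * B w z * (pauliMat σ x y * pauliMat σ z w) := by
    intro σ
    simp only [Matrix.trace, Matrix.diag, Matrix.mul_apply]
    rw [Finset.sum_mul]
    refine Finset.sum_congr rfl fun x _ => ?_
    rw [Finset.sum_mul]
    refine Finset.sum_congr rfl fun y _ => ?_
    rw [Finset.mul_sum]
    refine Finset.sum_congr rfl fun z _ => ?_
    rw [Finset.mul_sum]
    refine Finset.sum_congr rfl fun w _ => ?_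
    ring
  have h2 : ∑ σ : α → Pauli, (pauliMat σ * A).trace * (pauliMat σ * B).trace =
      ∑ x, ∑ y, ∑ z, ∑ w, A y x * B w z *
        ∑ σ : α → Pauli, pauliMat σ x y * pauliMat σ z w := by
    simp only [h1, Finset.mul_sum]
    rw [Finset.sum_comm]
    refine Finset.sum_congr rfl fun x _ => ?_
    rw [Finset.sum_comm]
    refine Finset.sum_congr rfl fun y _ => ?_
    rw [Finset.sum_comm]
    refine Finset.sum_congr rfl fun z _ => ?_
    rw [Finset.sum_comm]
  rw [h2]
  simp only [sum_pauliMat_mul_pauliMat, ite_and, mul_ite, mul_zero, Finset.sum_ite_eq,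
    Finset.mem_univ, if_true, Matrix.trace, Matrix.diag, Matrix.mul_apply, Finset.mul_sum]
  rw [Finset.sum_comm]
  refine Finset.sum_congr rfl fun y _ => Finset.sum_congr rfl fun x _ => ?_
  ring

/-- Every operator is the combination of Pauli strings given by its trace inner products. -/
lemma eq_sum_trace_smul_pauliMat (A : Matrix (α → Fin 2) (α → Fin 2) ℂ) :
    A = ∑ σ : α → Pauli, ((A * pauliMat σ).trace / 2 ^ Fintype.card α) • pauliMat σ := by
  ext x y
  have h1 : ∀ σ : α → Pauli, (A * pauliMat σ).trace / 2 ^ Fintype.card α * pauliMat σ x y =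
      (2 ^ Fintype.card α)⁻¹ * ((pauliMat σ * A).trace *
        (pauliMat σ * Matrix.single y x 1).trace) := by
    intro σ
    rw [Matrix.trace_mul_comm, Matrix.trace_mul_single]
    simp
    ring
  simp only [Matrix.sum_apply, Matrix.smul_apply, smul_eq_mul, h1]
  rw [← Finset.mul_sum, sum_trace_mul_trace, Matrix.trace_mul_single]
  simp

/-- The sign in `σ τ = ± τ σ` for Pauli strings. -/
def stringSign (σ τ : α → Pauli) : ℂ := ∏ q, commSign (σ q) (τ q)

lemma pauliMat_mul_comm_sign (σ τ : α → Pauli) :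
    pauliMat σ * pauliMat τ = stringSign σ τ • (pauliMat τ * pauliMat σ) := by
  simp only [pauliMat, tensorOp_mul, stringSign, ← tensorOp_smul]
  congr 1
  ext1 q
  exact toMatrix_mul_comm_sign _ _

lemma stringSign_update (σ : α → Pauli) (q : α) (r : Pauli) :
    stringSign σ (Function.update idString q r) = commSign (σ q) r := by
  rw [stringSign, Finset.prod_eq_single q]
  · simp
  · intro b _ hb
    simp [Function.update_of_ne hb, idString, commSign]
  · simp

/-- Distinct Pauli strings are told apart by the sign under conjugation by a Pauli string. -/
lemma exists_stringSign_mul_eq_neg_one {P P' : α → Pauli} (h : P ≠ P') :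
    ∃ R : α → Pauli, stringSign P R * stringSign P' R = -1 := by
  obtain ⟨q, hq⟩ := Function.ne_iff.mp h
  have : ∀ p p' : Pauli, p ≠ p' →
      ∃ r, ¬((p = .I ∨ r = .I ∨ p = r) ↔ (p' = .I ∨ r = .I ∨ p' = r)) := by decide
  obtain ⟨r, hr⟩ := this _ _ hq
  refine ⟨Function.update idString q r, ?_⟩
  rw [stringSign_update, stringSign_update, commSign, commSign]
  by_cases h1 : P q = .I ∨ r = .I ∨ P q = r <;> by_cases h2 : P' q = .I ∨ r = .I ∨ P' q = r
  · exact absurd (iff_of_true h1 h2) hr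
  · rw [if_pos h1, if_neg h2, one_mul]
  · rw [if_neg h1, if_pos h2, mul_one]
  · exact absurd (iff_of_false h1 h2) hr

/-- Any two non-identity Pauli strings have a common anticommuting Pauli string. -/
lemma exists_stringSign_eq_neg_one {P Q : α → Pauli} (hP : P ≠ idString) (hQ : Q ≠ idString) :
    ∃ R : α → Pauli, stringSign P R = -1 ∧ stringSign Q R = -1 := by
  have h2 : ∀ p p' : Pauli, p ≠ .I → p' ≠ .I →
      ∃ r, commSign p r = -1 ∧ commSign p' r = -1 := by
    have h3 : ∀ p p' : Pauli, p ≠ .I → p' ≠ .I →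
        ∃ r, ¬(p = .I ∨ r = .I ∨ p = r) ∧ ¬(p' = .I ∨ r = .I ∨ p' = r) := by decide
    intro p p' hp hp'
    obtain ⟨r, hr, hr'⟩ := h3 p p' hp hp'
    exact ⟨r, if_neg hr, if_neg hr'⟩
  obtain ⟨q, hq⟩ := exists_ne_of_ne_idString hP
  obtain ⟨q', hq'⟩ := exists_ne_of_ne_idString hQ
  by_cases h : Q q = .I
  · by_cases h' : P q' = .I
    · have hne : q ≠ q' := fun e => hq (e ▸ h')
      obtain ⟨r, hr, -⟩ := h2 _ _ hq hq
      obtain ⟨r', hr', -⟩ := h2 _ _ hq' hq'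
      refine ⟨Function.update (Function.update idString q r) q' r', ?_, ?_⟩
      · rw [stringSign, Finset.prod_eq_single q]
        · rw [Function.update_of_ne hne, Function.update_self, hr]
        · intro b _ hb
          by_cases hb' : b = q'
          · simp [hb', h', commSign]
          · simp [Function.update_of_ne hb, Function.update_of_ne hb', idString, commSign]
        · simp
      · rw [stringSign, Finset.prod_eq_single q']
        · rw [Function.update_self, hr']
        · intro b _ hb
          by_cases hb' : b = q
          · simp [hb', h, commSign]
          · simp [Function.update_of_ne hb, Function.update_of_ne hb', idString, commSign]
        · simp
    · obtain ⟨r, hr⟩ := h2 _ _ h' hq'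
      exact ⟨Function.update idString q' r, by simpa only [stringSign_update] using hr⟩
  · obtain ⟨r, hr⟩ := h2 _ _ hq h
    exact ⟨Function.update idString q r, by simpa only [stringSign_update] using hr⟩

lemma pauliMat_mem_unitaryGroup (σ : α → Pauli) :
    pauliMat σ ∈ Matrix.unitaryGroup (α → Fin 2) ℂ := by
  rw [Matrix.mem_unitaryGroup_iff, Matrix.star_eq_conjTranspose, conjTranspose_pauliMat,
    pauliMat_mul_self]

/-- Conjugation by `(P + R) / √2` exchanges the anticommuting Pauli strings `P` and `R`. -/
lemma exists_unitary_conj_pauliMat {P R : α → Pauli} (h : stringSign P R = -1) :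
    ∃ W : Matrix.unitaryGroup (α → Fin 2) ℂ, star W.1 * pauliMat P * W.1 = pauliMat R := by
  have hc := pauliMat_mul_comm_sign P R
  rw [h, neg_one_smul] at hc
  have hP := pauliMat_mul_self P
  have hR := pauliMat_mul_self R
  have hcP := conjTranspose_pauliMat P
  have hcR := conjTranspose_pauliMat R
  generalize pauliMat P = A at *
  generalize pauliMat R = B at *
  set c : ℂ := (((Real.sqrt 2)⁻¹ : ℝ) : ℂ) with hcdef
  have hcc : c * c = 1 / 2 := by
    rw [hcdef, ← Complex.ofReal_mul, ← mul_inv, Real.mul_self_sqrt (by norm_num)]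
    norm_num
  have hstar : star (c • (A + B)) = c • (A + B) := by
    rw [Matrix.star_eq_conjTranspose, Matrix.conjTranspose_smul, Matrix.conjTranspose_add, hcP, hcR]
    congr 1
    exact Complex.conj_ofReal _
  have hBAB : B * A * B = -A := by
    have : B * A = -(A * B) := by rw [hc, neg_neg]
    rw [this, neg_mul, mul_assoc, hR, mul_one]
  refine ⟨⟨c • (A + B), ?_⟩, ?_⟩
  · rw [Matrix.mem_unitaryGroup_iff, hstar, smul_mul_smul_comm, hcc, mul_add, add_mul, add_mul, hP,
      hR, hc]
    rw [show (1 : Matrix (α → Fin 2) (α → Fin 2) ℂ) + B * A + (-(B * A) + 1) = (2 : ℂ) • 1 by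
      rw [two_smul]; abel, smul_smul]
    norm_num
  · change star (c • (A + B)) * A * (c • (A + B)) = B
    rw [hstar, smul_mul_assoc, smul_mul_smul_comm, hcc]
    rw [show (A + B) * A * (A + B) = (2 : ℂ) • B by
      rw [add_mul, hP, add_mul, one_mul, mul_add, hBAB, mul_assoc, hP, mul_one, two_smul]; abel,
      smul_smul]
    norm_num

end Algebra

end PauliPath

/-! ### Second moments of unitary designs in the Pauli basis -/

namespace PauliPath

section Entries

variable {n : Type*} [Fintype n] [DecidableEq n]

lemma measurable_entry (i j : n) : Measurable fun U : Matrix.unitaryGroup n ℂ => U.1 i j :=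
  (continuous_subtype_val.matrix_elem i j).measurable

instance : IsProbabilityMeasure (unitaryHaar n) := ⟨Measure.haarMeasure_self⟩

instance : (unitaryHaar n).IsMulLeftInvariant :=
  inferInstanceAs (Measure.haarMeasure ⊤).IsMulLeftInvariant

/-- The product `tr (U† A U X) * tr (U† A' U X')`; its integral is the second moment of a random
unitary, as a functional of `A ⊗ A'` and `X ⊗ X'`. -/
noncomputable def tracePair (A A' X X' : Matrix n n ℂ) (U : Matrix.unitaryGroup n ℂ) : ℂ :=
  (star U.1 * A * U.1 * X).trace * (star U.1 * A' * U.1 * X').trace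

omit [DecidableEq n] in
lemma trace_conj_mul (A X U : Matrix n n ℂ) :
    (star U * A * U * X).trace =
      ∑ t : (n × n) × n × n, A t.1.1 t.1.2 * X t.2.2 t.2.1 *
        (U t.1.2 t.2.2 * star (U t.1.1 t.2.1)) := by
  rw [mul_assoc, mul_assoc, Matrix.trace_mul_comm, mul_assoc]
  simp only [Matrix.trace, Matrix.diag, Matrix.mul_apply, Fintype.sum_prod_type, Finset.sum_mul,
    Finset.mul_sum, Matrix.star_apply]
  refine Finset.sum_congr rfl fun i _ => Finset.sum_congr rfl fun j _ =>
    Finset.sum_congr rfl fun a _ => Finset.sum_congr rfl fun b _ => ?_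
  ring

lemma tracePair_eq_sum (A A' X X' : Matrix n n ℂ) (U : Matrix.unitaryGroup n ℂ) :
    tracePair A A' X X' U = ∑ t : (n × n) × n × n, ∑ t' : (n × n) × n × n,
      A t.1.1 t.1.2 * X t.2.2 t.2.1 * (A' t'.1.1 t'.1.2 * X' t'.2.2 t'.2.1) *
        (U.1 t.1.2 t.2.2 * U.1 t'.1.2 t'.2.2 * star (U.1 t.1.1 t.2.1) *
          star (U.1 t'.1.1 t'.2.1)) := by
  rw [tracePair, trace_conj_mul, trace_conj_mul, Finset.sum_mul]
  refine Finset.sum_congr rfl fun t _ => ?_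
  rw [Finset.mul_sum]
  refine Finset.sum_congr rfl fun t' _ => ?_
  ring

lemma measurable_trace_conj_mul (A X : Matrix n n ℂ) :
    Measurable fun U : Matrix.unitaryGroup n ℂ => (star U.1 * A * U.1 * X).trace := by
  simp only [trace_conj_mul]
  have h : ∀ i j : n, Measurable fun U : Matrix.unitaryGroup n ℂ => U.1 i j := measurable_entry
  have h' : ∀ i j : n, Measurable fun U : Matrix.unitaryGroup n ℂ => star (U.1 i j) :=
    fun i j => continuous_star.measurable.comp (h i j)
  exact Finset.measurable_sum _ fun t _ => ((h _ _).mul (h' _ _)).const_mul _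

lemma exists_norm_trace_conj_mul_le (A X : Matrix n n ℂ) :
    ∃ C, ∀ U : Matrix.unitaryGroup n ℂ, ‖(star U.1 * A * U.1 * X).trace‖ ≤ C := by
  refine ⟨∑ t : (n × n) × n × n, ‖A t.1.1 t.1.2 * X t.2.2 t.2.1‖, fun U => ?_⟩
  rw [trace_conj_mul]
  refine (norm_sum_le _ _).trans (Finset.sum_le_sum fun t _ => ?_)
  rw [norm_mul, norm_mul (U.1 _ _), norm_star]
  have h : ∀ i j, ‖U.1 i j‖ ≤ 1 := entry_norm_bound_of_unitary U.2
  exact mul_le_of_le_one_right (norm_nonneg _) (mul_le_one₀ (h _ _) (norm_nonneg _) (h _ _))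

variable {ν : Measure (Matrix.unitaryGroup n ℂ)}

lemma integrable_tracePair [IsFiniteMeasure ν] (A A' X X' : Matrix n n ℂ) :
    Integrable (tracePair A A' X X') ν := by
  obtain ⟨C, hC⟩ := exists_norm_trace_conj_mul_le A X
  obtain ⟨C', hC'⟩ := exists_norm_trace_conj_mul_le A' X'
  refine Integrable.of_bound ((measurable_trace_conj_mul A X).mul
    (measurable_trace_conj_mul A' X')).aestronglyMeasurable (C * C') (.of_forall fun U => ?_)
  rw [tracePair, norm_mul]
  exact mul_le_mul (hC U) (hC' U) (norm_nonneg _) ((norm_nonneg _).trans (hC U))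

lemma integrable_entries [IsFiniteMeasure ν] (i₁ j₁ i₂ j₂ i₃ j₃ i₄ j₄ : n) :
    Integrable (fun U : Matrix.unitaryGroup n ℂ =>
      U.1 i₁ j₁ * U.1 i₂ j₂ * star (U.1 i₃ j₃) * star (U.1 i₄ j₄)) ν := by
  have h : ∀ i j : n, Measurable fun U : Matrix.unitaryGroup n ℂ => U.1 i j := measurable_entry
  have h' : ∀ i j : n, Measurable fun U : Matrix.unitaryGroup n ℂ => star (U.1 i j) :=
    fun i j => continuous_star.measurable.comp (h i j)
  refine Integrable.of_bound ((((h _ _).mul (h _ _)).mul (h' _ _)).mul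
    (h' _ _)).aestronglyMeasurable 1 (.of_forall fun U => ?_)
  have hb : ∀ i j, ‖U.1 i j‖ ≤ 1 := entry_norm_bound_of_unitary U.2
  simp only [norm_mul, norm_star]
  exact mul_le_one₀ (mul_le_one₀ (mul_le_one₀ (hb _ _) (norm_nonneg _) (hb _ _))
    (norm_nonneg _) (hb _ _)) (norm_nonneg _) (hb _ _)

/-- The second moment is a combination of the moments that define a `2`-design. -/
lemma integral_tracePair_eq_haar [IsFiniteMeasure ν] (hν : IsTwoDesign ν)
    (A A' X X' : Matrix n n ℂ) :
    ∫ U, tracePair A A' X X' U ∂ν = ∫ U, tracePair A A' X X' U ∂(unitaryHaar n) := by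
  have key : ∀ (κ : Measure (Matrix.unitaryGroup n ℂ)) [IsFiniteMeasure κ],
      ∫ U, tracePair A A' X X' U ∂κ = ∑ t : (n × n) × n × n, ∑ t' : (n × n) × n × n,
        A t.1.1 t.1.2 * X t.2.2 t.2.1 * (A' t'.1.1 t'.1.2 * X' t'.2.2 t'.2.1) *
        ∫ U : Matrix.unitaryGroup n ℂ, U.1 t.1.2 t.2.2 * U.1 t'.1.2 t'.2.2 *
          star (U.1 t.1.1 t.2.1) * star (U.1 t'.1.1 t'.2.1) ∂κ := by
    intro κ _
    simp only [tracePair_eq_sum]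
    rw [integral_finsetSum _ fun t _ => integrable_finsetSum _ fun t' _ =>
      (integrable_entries _ _ _ _ _ _ _ _).const_mul _]
    refine Finset.sum_congr rfl fun t _ => ?_
    rw [integral_finsetSum _ fun t' _ => (integrable_entries _ _ _ _ _ _ _ _).const_mul _]
    exact Finset.sum_congr rfl fun t' _ => integral_const_mul _ _
  rw [key, key]
  refine Finset.sum_congr rfl fun t _ => Finset.sum_congr rfl fun t' _ => ?_
  rw [hν]

/-- Left invariance of the Haar measure. -/
lemma integral_tracePair_conj (W : Matrix.unitaryGroup n ℂ) (A A' X X' : Matrix n n ℂ) :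
    ∫ U, tracePair (star W.1 * A * W.1) (star W.1 * A' * W.1) X X' U ∂(unitaryHaar n) =
      ∫ U, tracePair A A' X X' U ∂(unitaryHaar n) := by
  rw [← integral_mul_left_eq_self (tracePair A A' X X') W]
  refine integral_congr_ae (.of_forall fun U => ?_)
  simp only [tracePair, Matrix.UnitaryGroup.mul_val, star_mul, mul_assoc]

end Entries

section Pauli

variable {α : Type*} [Fintype α] [DecidableEq α]

lemma conj_pauliMat (P R : α → Pauli) :
    star (pauliMat R) * pauliMat P * pauliMat R = stringSign P R • pauliMat P := by
  rw [Matrix.star_eq_conjTranspose, conjTranspose_pauliMat, mul_assoc, pauliMat_mul_comm_sign,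
    mul_smul_comm, ← mul_assoc, pauliMat_mul_self, one_mul]

/-- Invariance under a Pauli string that commutes with exactly one of `P`, `P'` makes the second
moment equal to its negative. -/
lemma integral_tracePair_of_ne {P P' : α → Pauli} (h : P ≠ P')
    (X X' : Matrix (α → Fin 2) (α → Fin 2) ℂ) :
    ∫ U, tracePair (pauliMat P) (pauliMat P') X X' U ∂(unitaryHaar (α → Fin 2)) = 0 := by
  obtain ⟨R, hR⟩ := exists_stringSign_mul_eq_neg_one h
  have h1 := integral_tracePair_conj ⟨pauliMat R, pauliMat_mem_unitaryGroup R⟩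
    (pauliMat P) (pauliMat P') X X'
  simp only [conj_pauliMat] at h1
  have h2 : ∀ U, tracePair (stringSign P R • pauliMat P) (stringSign P' R • pauliMat P') X X' U =
      -tracePair (pauliMat P) (pauliMat P') X X' U := by
    intro U
    simp only [tracePair, Matrix.mul_smul, Matrix.smul_mul, Matrix.trace_smul, smul_eq_mul]
    linear_combination (star U.1 * pauliMat P * U.1 * X).trace *
      (star U.1 * pauliMat P' * U.1 * X').trace * hR
  simp only [h2, integral_neg] at h1
  exact self_eq_neg.mp h1.symm

lemma integral_tracePair_eq_of_anticomm {P R : α → Pauli} (h : stringSign P R = -1)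
    (X X' : Matrix (α → Fin 2) (α → Fin 2) ℂ) :
    ∫ U, tracePair (pauliMat P) (pauliMat P) X X' U ∂(unitaryHaar (α → Fin 2)) =
      ∫ U, tracePair (pauliMat R) (pauliMat R) X X' U ∂(unitaryHaar (α → Fin 2)) := by
  obtain ⟨W, hW⟩ := exists_unitary_conj_pauliMat h
  rw [← integral_tracePair_conj W, hW]

/-- All non-identity Pauli strings have the same diagonal second moment. -/
lemma integral_tracePair_eq_of_ne_idString {P Q : α → Pauli} (hP : P ≠ idString)
    (hQ : Q ≠ idString) (X X' : Matrix (α → Fin 2) (α → Fin 2) ℂ) :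
    ∫ U, tracePair (pauliMat P) (pauliMat P) X X' U ∂(unitaryHaar (α → Fin 2)) =
      ∫ U, tracePair (pauliMat Q) (pauliMat Q) X X' U ∂(unitaryHaar (α → Fin 2)) := by
  obtain ⟨R, hR, hR'⟩ := exists_stringSign_eq_neg_one hP hQ
  rw [integral_tracePair_eq_of_anticomm hR, integral_tracePair_eq_of_anticomm hR']

lemma sum_tracePair (X X' : Matrix (α → Fin 2) (α → Fin 2) ℂ)
    (U : Matrix.unitaryGroup (α → Fin 2) ℂ) :
    ∑ P : α → Pauli, tracePair (pauliMat P) (pauliMat P) X X' U =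
      2 ^ Fintype.card α * (X * X').trace := by
  have hU : star U.1 * U.1 = 1 := Matrix.mem_unitaryGroup_iff'.mp U.2
  have h : ∀ (P : α → Pauli) (Y : Matrix (α → Fin 2) (α → Fin 2) ℂ),
      (star U.1 * pauliMat P * U.1 * Y).trace = (pauliMat P * (U.1 * Y * star U.1)).trace := by
    intro P Y
    rw [mul_assoc, mul_assoc, Matrix.trace_mul_comm, mul_assoc]
  simp only [tracePair, h]
  rw [sum_trace_mul_trace]
  congr 1
  rw [show U.1 * X * star U.1 * (U.1 * X' * star U.1) = U.1 * (X * X') * star U.1 by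
    rw [mul_assoc, ← mul_assoc (star U.1), ← mul_assoc (star U.1), hU, one_mul]
    simp only [mul_assoc], Matrix.trace_mul_comm, ← mul_assoc, hU, one_mul]

lemma card_pauli : Fintype.card Pauli = 4 := rfl

/-- The diagonal second moment, obtained by summing over all Pauli strings: the `4 ^ |α| - 1`
non-identity strings contribute equally. -/
lemma integral_tracePair_pauliMat {P : α → Pauli} (hP : P ≠ idString)
    (X X' : Matrix (α → Fin 2) (α → Fin 2) ℂ) :
    (4 ^ Fintype.card α - 1) *
      ∫ U, tracePair (pauliMat P) (pauliMat P) X X' U ∂(unitaryHaar (α → Fin 2)) =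
      2 ^ Fintype.card α * (X * X').trace - X.trace * X'.trace := by
  have h1 : ∑ Q : α → Pauli,
      ∫ U, tracePair (pauliMat Q) (pauliMat Q) X X' U ∂(unitaryHaar (α → Fin 2)) =
      2 ^ Fintype.card α * (X * X').trace := by
    rw [← integral_finsetSum _ fun Q _ => integrable_tracePair _ _ _ _]
    simp [sum_tracePair]
  have h2 : ∫ U, tracePair (pauliMat idString) (pauliMat idString) X X' U
      ∂(unitaryHaar (α → Fin 2)) = X.trace * X'.trace := by
    have : ∀ U : Matrix.unitaryGroup (α → Fin 2) ℂ,
        tracePair (pauliMat idString) (pauliMat idString) X X' U = X.trace * X'.trace := by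
      intro U
      have hU : star U.1 * U.1 = 1 := Matrix.mem_unitaryGroup_iff'.mp U.2
      simp [tracePair, pauliMat_idString, hU]
    simp [this]
  rw [← Finset.add_sum_erase _ _ (Finset.mem_univ idString), h2,
    Finset.sum_congr rfl fun Q hQ =>
      integral_tracePair_eq_of_ne_idString (Finset.ne_of_mem_erase hQ) hP X X',
    Finset.sum_const, Finset.card_erase_of_mem (Finset.mem_univ _), Finset.card_univ,
    Fintype.card_fun, card_pauli, nsmul_eq_mul,
    Nat.cast_sub (Nat.one_le_pow _ _ (by norm_num))] at h1
  push_cast at h1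
  linear_combination h1

/-- The coefficient of `Q` in the Pauli expansion of `U† P U`. -/
noncomputable def pauliCoeff (U : Matrix.unitaryGroup (α → Fin 2) ℂ) (P Q : α → Pauli) : ℂ :=
  (star U.1 * pauliMat P * U.1 * pauliMat Q).trace / 2 ^ Fintype.card α

/-- The mean square of the coefficient of `Q` in `U† P U` for a random `U`, for `P` and `Q` that
are both the identity string or both not. -/
noncomputable def pauliWeight (Q : α → Pauli) : ℝ :=
  if Q = idString then 1 else (4 ^ Fintype.card α - 1)⁻¹

omit [DecidableEq α] in
lemma pauliWeight_nonneg (Q : α → Pauli) : 0 ≤ pauliWeight Q := by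
  unfold pauliWeight
  split_ifs
  · exact zero_le_one
  · exact inv_nonneg.mpr (sub_nonneg.mpr (one_le_pow₀ (by norm_num)))

lemma sum_pauliCoeff_smul (U : Matrix.unitaryGroup (α → Fin 2) ℂ) (P : α → Pauli) :
    star U.1 * pauliMat P * U.1 = ∑ Q, pauliCoeff U P Q • pauliMat Q :=
  eq_sum_trace_smul_pauliMat _

lemma measurable_pauliCoeff (P Q : α → Pauli) : Measurable fun U => pauliCoeff U P Q :=
  (measurable_trace_conj_mul _ _).div_const _

lemma exists_norm_pauliCoeff_le (P Q : α → Pauli) : ∃ C, ∀ U, ‖pauliCoeff U P Q‖ ≤ C := by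
  obtain ⟨C, hC⟩ := exists_norm_trace_conj_mul_le (pauliMat P) (pauliMat Q)
  refine ⟨C / ‖(2 : ℂ) ^ Fintype.card α‖, fun U => ?_⟩
  rw [pauliCoeff, norm_div]
  exact div_le_div_of_nonneg_right (hC U) (norm_nonneg _)

lemma pauliCoeff_mul_pauliCoeff (P P' Q Q' : α → Pauli) (U : Matrix.unitaryGroup (α → Fin 2) ℂ) :
    pauliCoeff U P Q * pauliCoeff U P' Q' =
      (4 ^ Fintype.card α)⁻¹ *
        tracePair (pauliMat P) (pauliMat P') (pauliMat Q) (pauliMat Q') U := by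
  rw [pauliCoeff, pauliCoeff, tracePair, div_mul_div_comm, ← mul_pow, div_eq_inv_mul]
  norm_num

/-- A `2`-design maps a non-identity Pauli string to every non-identity Pauli string with equal
probability, and distinct Pauli strings are uncorrelated. -/
lemma integral_pauliCoeff_mul_pauliCoeff {ν : Measure (Matrix.unitaryGroup (α → Fin 2) ℂ)}
    [IsFiniteMeasure ν] (hν : IsTwoDesign ν) (P P' Q Q' : α → Pauli) :
    ∫ U, pauliCoeff U P Q * pauliCoeff U P' Q' ∂ν =
      if P = P' ∧ Q = Q' ∧ (Q = idString ↔ P = idString) then (pauliWeight Q : ℂ) else 0 := by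
  simp only [pauliCoeff_mul_pauliCoeff]
  rw [integral_const_mul, integral_tracePair_eq_haar hν]
  by_cases hPP : P = P'
  swap
  · rw [integral_tracePair_of_ne hPP, if_neg fun h => hPP h.1, mul_zero]
  subst hPP
  have h4 : (4 : ℂ) ^ Fintype.card α = 2 ^ Fintype.card α * 2 ^ Fintype.card α := by
    rw [← mul_pow]; norm_num
  have h2 : (2 : ℂ) ^ Fintype.card α ≠ 0 := pow_ne_zero _ two_ne_zero
  by_cases hP : P = idString
  · have : ∀ U : Matrix.unitaryGroup (α → Fin 2) ℂ,
        tracePair (pauliMat P) (pauliMat P) (pauliMat Q) (pauliMat Q') U =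
          (pauliMat Q).trace * (pauliMat Q').trace := by
      intro U
      have hU : star U.1 * U.1 = 1 := Matrix.mem_unitaryGroup_iff'.mp U.2
      simp [tracePair, hP, pauliMat_idString, hU]
    simp only [this, trace_pauliMat]
    by_cases hQ : Q = idString
    · by_cases hQ' : Q' = idString
      · simp [hP, hQ, hQ', pauliWeight, h4]
        field_simp
      · simp [hQ, hQ', Ne.symm hQ']
    · simp [hP, hQ]
  · have h := integral_tracePair_pauliMat hP (pauliMat Q) (pauliMat Q')
    have h41 : (4 : ℂ) ^ Fintype.card α - 1 ≠ 0 := by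
      have hne : Fintype.card α ≠ 0 := by
        obtain ⟨q, -⟩ := exists_ne_of_ne_idString hP
        exact (Fintype.card_pos_iff.mpr ⟨q⟩).ne'
      have : (1 : ℝ) < 4 ^ Fintype.card α := one_lt_pow₀ (by norm_num) hne
      rw [sub_ne_zero]
      exact_mod_cast this.ne'
    rw [mul_comm, ← eq_div_iff h41] at h
    rw [h, trace_pauliMat_mul, trace_pauliMat, trace_pauliMat, h4]
    by_cases hQ : Q = idString
    · by_cases hQ' : Q' = idString
      · simp [hP, hQ, hQ']
      · simp [hP, hQ, hQ', Ne.symm hQ']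
    · by_cases hQQ : Q = Q'
      · subst hQQ
        simp [hP, hQ, pauliWeight, h4]
        field_simp
      · simp [hQ, hQQ]

end Pauli
end PauliPath

/-! ### Evolution of Pauli strings through the circuit -/

namespace PauliPath

section Circuit

open scoped Kronecker

variable {N M : ℕ}

/-- The part of a Pauli string on the qubits in `s`. -/
def restrictString (s : Finset (Fin N)) (σ : Fin N → Pauli) : s → Pauli := fun q => σ q

/-- The Pauli string `σ` with its part on `s` replaced by `Q`. -/
def replaceString (s : Finset (Fin N)) (σ : Fin N → Pauli) (Q : s → Pauli) : Fin N → Pauli :=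
  fun q => if hq : q ∈ s then Q ⟨q, hq⟩ else σ q

/-- Splits a computational basis state into its parts inside and outside `s`. -/
def splitEquiv (s : Finset (Fin N)) :
    (Fin N → Fin 2) ≃ ((s → Fin 2) × ({q // q ∉ s} → Fin 2)) :=
  Equiv.piEquivPiSubtypeProd (· ∈ s) fun _ => Fin 2

lemma liftOp_eq_submatrix (s : Finset (Fin N)) (A : Matrix (s → Fin 2) (s → Fin 2) ℂ) :
    liftOp s A = (A ⊗ₖ (1 : Matrix ({q // q ∉ s} → Fin 2) _ ℂ)).submatrix
      (splitEquiv s) (splitEquiv s) := by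
  ext x y
  simp only [liftOp, Matrix.of_apply, Matrix.submatrix_apply, Matrix.kroneckerMap_apply,
    Matrix.one_apply, mul_ite, mul_one, mul_zero]
  refine if_congr ?_ rfl rfl
  rw [funext_iff, Subtype.forall]
  rfl

lemma pauliOp_eq_submatrix (s : Finset (Fin N)) (σ : Fin N → Pauli) :
    pauliOp σ = (pauliMat (restrictString s σ) ⊗ₖ
      pauliMat (fun q : {q // q ∉ s} => σ q)).submatrix (splitEquiv s) (splitEquiv s) := by
  ext x y
  rw [Matrix.submatrix_apply, Matrix.kroneckerMap_apply, pauliOp, Matrix.of_apply,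
    ← Fintype.prod_subtype_mul_prod_subtype (· ∈ s)]
  congr 1
  exact Finset.prod_congr (by ext; simp) fun _ _ => rfl

lemma star_liftOp (s : Finset (Fin N)) (A : Matrix (s → Fin 2) (s → Fin 2) ℂ) :
    star (liftOp s A) = liftOp s (star A) := by
  simp only [liftOp_eq_submatrix, Matrix.star_eq_conjTranspose, Matrix.conjTranspose_submatrix,
    Matrix.conjTranspose_kronecker, Matrix.conjTranspose_one]

lemma liftOp_mul (s : Finset (Fin N)) (A A' : Matrix (s → Fin 2) (s → Fin 2) ℂ) :
    liftOp s A * liftOp s A' = liftOp s (A * A') := by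
  simp only [liftOp_eq_submatrix, Matrix.submatrix_mul_equiv, ← Matrix.mul_kronecker_mul, mul_one]

lemma liftOp_one (s : Finset (Fin N)) : liftOp s 1 = 1 := by
  rw [liftOp_eq_submatrix, Matrix.one_kronecker_one, Matrix.submatrix_one_equiv]

/-- A block turns a Pauli string into a combination of the strings that agree with it off the
support of the block. -/
lemma star_liftOp_mul_pauliOp_mul_liftOp (s : Finset (Fin N))
    (U : Matrix.unitaryGroup (s → Fin 2) ℂ) (σ : Fin N → Pauli) :
    star (liftOp s U.1) * pauliOp σ * liftOp s U.1 =
      ∑ Q, pauliCoeff U (restrictString s σ) Q • pauliOp (replaceString s σ Q) := by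
  have h : ∀ Q : s → Pauli, pauliOp (replaceString s σ Q) =
      (pauliMat Q ⊗ₖ pauliMat (fun q : {q // q ∉ s} => σ q)).submatrix
        (splitEquiv s) (splitEquiv s) := by
    intro Q
    rw [pauliOp_eq_submatrix s]
    congr 3
    · ext q
      simp [restrictString, replaceString]
    · ext q
      simp [replaceString, q.2]
  rw [star_liftOp, liftOp_eq_submatrix, liftOp_eq_submatrix, pauliOp_eq_submatrix s σ,
    Matrix.submatrix_mul_equiv, Matrix.submatrix_mul_equiv, ← Matrix.mul_kronecker_mul,
    ← Matrix.mul_kronecker_mul, sum_pauliCoeff_smul, one_mul, mul_one]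
  ext x y
  simp only [h, Matrix.submatrix_apply, Matrix.kroneckerMap_apply, Matrix.sum_apply,
    Matrix.smul_apply, smul_eq_mul, Finset.sum_mul, mul_assoc]

lemma circuitUnitary_succ (s : Fin (M + 1) → Finset (Fin N))
    (B : (k : Fin (M + 1)) → Matrix.unitaryGroup (s k → Fin 2) ℂ) :
    circuitUnitary s B = liftOp (s (Fin.last M)) (B (Fin.last M)).1 *
      circuitUnitary (fun k : Fin M => s k.castSucc) fun k => B k.castSucc := by
  rw [circuitUnitary, List.ofFn_succ', List.concat_eq_append, List.reverse_append]
  simp [circuitUnitary]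

lemma star_circuitUnitary_mul_self (s : Fin M → Finset (Fin N))
    (B : (k : Fin M) → Matrix.unitaryGroup (s k → Fin 2) ℂ) :
    star (circuitUnitary s B) * circuitUnitary s B = 1 := by
  induction M with
  | zero => simp [circuitUnitary]
  | succ M ih =>
    have hU : star (B (Fin.last M)).1 * (B (Fin.last M)).1 = 1 :=
      Matrix.mem_unitaryGroup_iff'.mp (B (Fin.last M)).2
    rw [circuitUnitary_succ, star_mul, mul_assoc, ← mul_assoc (star (liftOp _ _)), star_liftOp,
      liftOp_mul, hU, liftOp_one, one_mul, ih]

/-- The expectation `⟨0|U† σ U|0⟩` of a Pauli string after the circuit `U`. -/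
def pauliExpect (s : Fin M → Finset (Fin N))
    (B : (k : Fin M) → Matrix.unitaryGroup (s k → Fin 2) ℂ) (σ : Fin N → Pauli) : ℂ :=
  (star (circuitUnitary s B) * pauliOp σ * circuitUnitary s B) 0 0

lemma pauliExpect_zero (s : Fin 0 → Finset (Fin N))
    (B : (k : Fin 0) → Matrix.unitaryGroup (s k → Fin 2) ℂ) (σ : Fin N → Pauli) :
    pauliExpect s B σ = if ∀ q, σ q = .I ∨ σ q = .Z then 1 else 0 := by
  simp only [pauliExpect, circuitUnitary, List.ofFn_zero, List.reverse_nil, List.prod_nil,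
    star_one, one_mul, mul_one, pauliOp, Matrix.of_apply, Pi.zero_apply]
  split_ifs with h
  · refine Finset.prod_eq_one fun q _ => ?_
    rcases h q with h | h <;> simp [h, Pauli.toMatrix]
  · push Not at h
    obtain ⟨q, hI, hZ⟩ := h
    refine Finset.prod_eq_zero (Finset.mem_univ q) ?_
    cases hq : σ q <;> simp_all [Pauli.toMatrix]

lemma pauliExpect_succ (s : Fin (M + 1) → Finset (Fin N))
    (B : (k : Fin (M + 1)) → Matrix.unitaryGroup (s k → Fin 2) ℂ) (σ : Fin N → Pauli) :
    pauliExpect s B σ = ∑ Q, pauliCoeff (B (Fin.last M)) (restrictString _ σ) Q *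
      pauliExpect (fun k : Fin M => s k.castSucc) (fun k => B k.castSucc)
        (replaceString _ σ Q) := by
  have h : ∀ V A C : Matrix (Fin N → Fin 2) (Fin N → Fin 2) ℂ,
      star (A * V) * C * (A * V) = star V * (star A * C * A) * V := by
    intro V A C
    simp only [star_mul, mul_assoc]
  rw [pauliExpect, circuitUnitary_succ, h, star_liftOp_mul_pauliOp_mul_liftOp,
    Finset.mul_sum, Finset.sum_mul, Matrix.sum_apply]
  simp only [pauliExpect, Matrix.mul_smul, Matrix.smul_mul, Matrix.smul_apply, smul_eq_mul]

lemma pauliExpect_idString (s : Fin M → Finset (Fin N))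
    (B : (k : Fin M) → Matrix.unitaryGroup (s k → Fin 2) ℂ) :
    pauliExpect s B idString = 1 := by
  rw [pauliExpect, show pauliOp (idString : Fin N → Pauli) = 1 from pauliMat_idString, mul_one,
    star_circuitUnitary_mul_self, Matrix.one_apply_eq]

lemma star_pauliExpect (s : Fin M → Finset (Fin N))
    (B : (k : Fin M) → Matrix.unitaryGroup (s k → Fin 2) ℂ) (σ : Fin N → Pauli) :
    star (pauliExpect s B σ) = pauliExpect s B σ := by
  rw [pauliExpect, ← Matrix.star_apply, star_mul, star_mul, star_star, mul_assoc,
    Matrix.star_eq_conjTranspose (pauliOp σ),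
    show (pauliOp σ).conjTranspose = pauliOp σ from conjTranspose_pauliMat σ]

lemma measurable_pauliExpect (s : Fin M → Finset (Fin N)) (σ : Fin N → Pauli) :
    Measurable fun B : (k : Fin M) → Matrix.unitaryGroup (s k → Fin 2) ℂ =>
      pauliExpect s B σ := by
  induction M generalizing σ with
  | zero => simp only [pauliExpect_zero]; exact measurable_const
  | succ M ih =>
    simp only [pauliExpect_succ]
    refine Finset.measurable_sum _ fun Q _ => Measurable.mul ?_ ?_
    · exact (measurable_pauliCoeff _ _).comp (measurable_pi_apply _)
    · exact (ih (fun k => s k.castSucc) _).comp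
        (measurable_pi_lambda _ fun k => measurable_pi_apply k.castSucc)

lemma exists_norm_pauliExpect_le (s : Fin M → Finset (Fin N)) (σ : Fin N → Pauli) :
    ∃ C, ∀ B : (k : Fin M) → Matrix.unitaryGroup (s k → Fin 2) ℂ, ‖pauliExpect s B σ‖ ≤ C := by
  induction M generalizing σ with
  | zero =>
    refine ⟨1, fun B => ?_⟩
    rw [pauliExpect_zero]
    split_ifs <;> simp
  | succ M ih =>
    choose C hC using fun Q => exists_norm_pauliCoeff_le (restrictString (s (Fin.last M)) σ) Q
    choose D hD using fun Q => ih (fun k => s k.castSucc) (replaceString (s (Fin.last M)) σ Q)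
    refine ⟨∑ Q, C Q * D Q, fun B => ?_⟩
    rw [pauliExpect_succ]
    refine (norm_sum_le _ _).trans (Finset.sum_le_sum fun Q _ => ?_)
    rw [norm_mul]
    exact mul_le_mul (hC Q _) (hD Q _) (norm_nonneg _) ((norm_nonneg _).trans (hC Q 1))

/-- `IsPauliTrajectory s σ Q` says that the Pauli string `σ`, moved backward through the blocks,
can end in a string of `I`s and `Z`s while block `k` leaves the string `Q k` on its support: a block
leaves the identity exactly where it meets the identity. -/
def IsPauliTrajectory : {M : ℕ} → (s : Fin M → Finset (Fin N)) → (Fin N → Pauli) →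
    ((k : Fin M) → s k → Pauli) → Prop
  | 0, _, σ, _ => ∀ q, σ q = .I ∨ σ q = .Z
  | M + 1, s, σ, Q =>
    (Q (Fin.last M) = idString ↔ restrictString (s (Fin.last M)) σ = idString) ∧
      IsPauliTrajectory (fun k : Fin M => s k.castSucc)
        (replaceString (s (Fin.last M)) σ (Q (Fin.last M))) fun k => Q k.castSucc

open Classical in
/-- The mean square of `⟨0|U† σ U|0⟩`, as a sum over the trajectories of `σ`. -/
noncomputable def trajectorySum (s : Fin M → Finset (Fin N)) (σ : Fin N → Pauli) : ℝ :=
  ∑ Q : (k : Fin M) → s k → Pauli,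
    if IsPauliTrajectory s σ Q then ∏ k, pauliWeight (Q k) else 0

lemma trajectorySum_zero (s : Fin 0 → Finset (Fin N)) (σ : Fin N → Pauli) :
    trajectorySum s σ = if ∀ q, σ q = .I ∨ σ q = .Z then 1 else 0 := by
  simp [trajectorySum, IsPauliTrajectory]

lemma trajectorySum_succ (s : Fin (M + 1) → Finset (Fin N)) (σ : Fin N → Pauli) :
    trajectorySum s σ = ∑ Q : s (Fin.last M) → Pauli,
      if Q = idString ↔ restrictString (s (Fin.last M)) σ = idString then
        pauliWeight Q * trajectorySum (fun k : Fin M => s k.castSucc)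
          (replaceString (s (Fin.last M)) σ Q) else 0 := by
  classical
  unfold trajectorySum
  rw [← (Fin.snocEquiv fun k => s k → Pauli).sum_comp, Fintype.sum_prod_type]
  refine Finset.sum_congr rfl fun Q _ => ?_
  split_ifs with h
  · rw [Finset.mul_sum]
    refine Finset.sum_congr rfl fun R _ => ?_
    simp [Fin.snocEquiv, IsPauliTrajectory, Fin.prod_univ_castSucc, h, mul_comm]
  · refine Finset.sum_eq_zero fun R _ => ?_
    simp [Fin.snocEquiv, IsPauliTrajectory, h]

variable {Θ : Type*} [MeasurableSpace Θ] {μ : Measure Θ} [IsProbabilityMeasure μ]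

omit [IsProbabilityMeasure μ] in
lemma indepFun_last_init {s : Fin (M + 1) → Finset (Fin N)}
    {B : (k : Fin (M + 1)) → Θ → Matrix.unitaryGroup (s k → Fin 2) ℂ}
    (hB : ∀ k, Measurable (B k)) (hindep : iIndepFun B μ) :
    IndepFun (B (Fin.last M)) (fun θ (k : Fin M) => B k.castSucc θ) μ := by
  have h := hindep.indepFun_finset {Fin.last M} (Finset.univ.erase (Fin.last M)) (by simp) hB
  have hlast : Fin.last M ∈ ({Fin.last M} : Finset (Fin (M + 1))) := Finset.mem_singleton_self _
  have hcast : ∀ k : Fin M, k.castSucc ∈ Finset.univ.erase (Fin.last M) := fun k =>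
    Finset.mem_erase.mpr ⟨Fin.castSucc_ne_last k, Finset.mem_univ _⟩
  exact IndepFun.comp (φ := fun x => x ⟨Fin.last M, hlast⟩)
    (ψ := fun y (k : Fin M) => y ⟨k.castSucc, hcast k⟩) h
    (measurable_pi_apply (X := fun i : ({Fin.last M} : Finset (Fin (M + 1))) =>
      Matrix.unitaryGroup (s i → Fin 2) ℂ) ⟨Fin.last M, hlast⟩)
    (measurable_pi_lambda _ fun k => measurable_pi_apply
      (X := fun i : (Finset.univ.erase (Fin.last M) : Finset (Fin (M + 1))) =>
        Matrix.unitaryGroup (s i → Fin 2) ℂ) ⟨k.castSucc, hcast k⟩)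

lemma integrable_pauliExpect_mul {s : Fin M → Finset (Fin N)}
    {B : (k : Fin M) → Θ → Matrix.unitaryGroup (s k → Fin 2) ℂ}
    (hB : ∀ k, Measurable (B k)) (σ τ : Fin N → Pauli) :
    Integrable (fun θ =>
      pauliExpect s (fun k => B k θ) σ * pauliExpect s (fun k => B k θ) τ) μ := by
  obtain ⟨C, hC⟩ := exists_norm_pauliExpect_le s σ
  obtain ⟨D, hD⟩ := exists_norm_pauliExpect_le s τ
  have hm : Measurable fun θ k => B k θ := measurable_pi_lambda _ hB
  refine Integrable.of_bound (((measurable_pauliExpect s σ).comp hm).mul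
    ((measurable_pauliExpect s τ).comp hm)).aestronglyMeasurable (C * D) (.of_forall fun θ => ?_)
  rw [norm_mul]
  exact mul_le_mul (hC _) (hD _) (norm_nonneg _) ((norm_nonneg _).trans (hC fun k => B k θ))

lemma integrable_pauliCoeff_mul {α : Type*} [Fintype α] [DecidableEq α]
    {ν : Measure (Matrix.unitaryGroup (α → Fin 2) ℂ)} [IsFiniteMeasure ν] (P P' Q Q' : α → Pauli) :
    Integrable (fun U => pauliCoeff U P Q * pauliCoeff U P' Q') ν := by
  simp only [pauliCoeff_mul_pauliCoeff]
  exact (integrable_tracePair _ _ _ _).const_mul _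

/-- Averaging over independent `2`-designs: expectations of distinct Pauli strings are uncorrelated
as soon as the strings differ on some block, and the mean squares are sums over trajectories. -/
theorem integral_pauliExpect_mul {s : Fin M → Finset (Fin N)}
    {B : (k : Fin M) → Θ → Matrix.unitaryGroup (s k → Fin 2) ℂ}
    (hB : ∀ k, Measurable (B k)) (hindep : iIndepFun B μ)
    (hdesign : ∀ k, IsTwoDesign (μ.map (B k))) {σ τ : Fin N → Pauli}
    (hστ : σ ≠ τ → ∃ q, σ q ≠ τ q ∧ ∃ k, q ∈ s k) :
    ∫ θ, pauliExpect s (fun k => B k θ) σ * pauliExpect s (fun k => B k θ) τ ∂μ =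
      if σ = τ then (trajectorySum s σ : ℂ) else 0 := by
  induction M generalizing σ τ with
  | zero =>
    split_ifs with h
    · subst h
      rw [trajectorySum_zero]
      simp only [pauliExpect_zero]
      split_ifs <;> simp
    · obtain ⟨q, -, k, -⟩ := hστ h
      exact k.elim0
  | succ M ih =>
    set t := s (Fin.last M)
    have hfin := fun k => Measure.isProbabilityMeasure_map (μ := μ) (hB k).aemeasurable
    have hind := indepFun_last_init hB hindep
    have hB' : ∀ k : Fin M, Measurable (B k.castSucc) := fun k => hB _
    have hindep' : iIndepFun (fun k : Fin M => B k.castSucc) μ :=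
      hindep.precomp (Fin.castSucc_injective M)
    have key : ∀ (P P' Q Q' : t → Pauli) (σ' τ' : Fin N → Pauli),
        Integrable (fun θ => pauliCoeff (B (Fin.last M) θ) P Q *
            pauliCoeff (B (Fin.last M) θ) P' Q' *
          (pauliExpect (fun k : Fin M => s k.castSucc) (fun k => B k.castSucc θ) σ' *
            pauliExpect (fun k : Fin M => s k.castSucc) (fun k => B k.castSucc θ) τ')) μ ∧
        ∫ θ, pauliCoeff (B (Fin.last M) θ) P Q * pauliCoeff (B (Fin.last M) θ) P' Q' *
          (pauliExpect (fun k : Fin M => s k.castSucc) (fun k => B k.castSucc θ) σ' *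
            pauliExpect (fun k : Fin M => s k.castSucc) (fun k => B k.castSucc θ) τ') ∂μ =
        (if P = P' ∧ Q = Q' ∧ (Q = idString ↔ P = idString) then (pauliWeight Q : ℂ) else 0) *
        ∫ θ, pauliExpect (fun k : Fin M => s k.castSucc) (fun k => B k.castSucc θ) σ' *
            pauliExpect (fun k : Fin M => s k.castSucc) (fun k => B k.castSucc θ) τ' ∂μ := by
      intro P P' Q Q' σ' τ'
      have hc : Measurable fun U => pauliCoeff U P Q * pauliCoeff U P' Q' :=
        (measurable_pauliCoeff P Q).mul (measurable_pauliCoeff P' Q')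
      have hi := hind.comp hc ((measurable_pauliExpect (fun k : Fin M => s k.castSucc) σ').mul
        (measurable_pauliExpect (fun k : Fin M => s k.castSucc) τ'))
      have hi1 : Integrable (fun θ => pauliCoeff (B (Fin.last M) θ) P Q *
          pauliCoeff (B (Fin.last M) θ) P' Q') μ :=
        (integrable_pauliCoeff_mul P P' Q Q').comp_measurable (hB (Fin.last M))
      have hi2 := integrable_pauliExpect_mul (μ := μ) hB' σ' τ'
      refine ⟨hi.integrable_mul hi1 hi2, ?_⟩
      rw [← integral_pauliCoeff_mul_pauliCoeff (hdesign (Fin.last M)),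
        integral_map (hB _).aemeasurable hc.aestronglyMeasurable]
      exact hi.integral_fun_mul_eq_mul_integral hi1.aestronglyMeasurable hi2.aestronglyMeasurable
    have hexp : ∀ θ, pauliExpect s (fun k => B k θ) σ * pauliExpect s (fun k => B k θ) τ =
        ∑ Q, ∑ Q', pauliCoeff (B (Fin.last M) θ) (restrictString t σ) Q *
            pauliCoeff (B (Fin.last M) θ) (restrictString t τ) Q' *
          (pauliExpect (fun k : Fin M => s k.castSucc) (fun k => B k.castSucc θ)
              (replaceString t σ Q) *
            pauliExpect (fun k : Fin M => s k.castSucc) (fun k => B k.castSucc θ)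
              (replaceString t τ Q')) := by
      intro θ
      rw [pauliExpect_succ, pauliExpect_succ, Finset.sum_mul]
      refine Finset.sum_congr rfl fun Q _ => ?_
      rw [Finset.mul_sum]
      exact Finset.sum_congr rfl fun Q' _ => mul_mul_mul_comm _ _ _ _
    simp only [hexp]
    rw [integral_finsetSum _ fun Q _ => integrable_finsetSum _ fun Q' _ => (key _ _ _ _ _ _).1]
    rw [Finset.sum_congr rfl fun Q _ => integral_finsetSum _ fun Q' _ => (key _ _ _ _ _ _).1]
    rw [Finset.sum_congr rfl fun Q _ => Finset.sum_congr rfl fun Q' _ => (key _ _ _ _ _ _).2]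
    -- Strings that differ inside the last block are decorrelated by it; otherwise they differ
    -- outside, and the difference survives until an earlier block.
    by_cases hr : restrictString t σ = restrictString t τ
    · have hne : σ ≠ τ → ∀ Q, replaceString t σ Q ≠ replaceString t τ Q ∧
          ∃ q, replaceString t σ Q q ≠ replaceString t τ Q q ∧
            ∃ k : Fin M, q ∈ s k.castSucc := by
        intro h Q
        obtain ⟨q, hq, k, hk⟩ := hστ h
        have hqt : q ∉ t := fun hqt => hq (congrFun hr ⟨q, hqt⟩)
        have hq' : replaceString t σ Q q ≠ replaceString t τ Q q := by
          simpa [replaceString, hqt] using hq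
        refine ⟨fun e => hq' (congrFun e q), q, hq', ?_⟩
        induction k using Fin.lastCases with
        | last => exact absurd hk hqt
        | cast k => exact ⟨k, hk⟩
      have hstep : ∀ Q, ∑ Q', (if restrictString t σ = restrictString t τ ∧ Q = Q' ∧
            (Q = idString ↔ restrictString t σ = idString) then (pauliWeight Q : ℂ) else 0) *
          ∫ θ, pauliExpect (fun k : Fin M => s k.castSucc) (fun k => B k.castSucc θ)
              (replaceString t σ Q) *
            pauliExpect (fun k : Fin M => s k.castSucc) (fun k => B k.castSucc θ)
              (replaceString t τ Q') ∂μ =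
          if Q = idString ↔ restrictString t σ = idString then (pauliWeight Q : ℂ) *
            (if σ = τ then (trajectorySum (fun k : Fin M => s k.castSucc)
              (replaceString t σ Q) : ℂ) else 0) else 0 := by
        intro Q
        rw [Finset.sum_eq_single Q]
        · rw [ih hB' hindep' (fun k => hdesign _) (σ := replaceString t σ Q)
            (τ := replaceString t τ Q)]
          · by_cases h : σ = τ
            · subst h
              simp
            · simp [h, (hne h Q).1]
          · intro h
            exact (hne (fun e => h (by rw [e])) Q).2
        · intro Q' _ hQ
          simp [hQ.symm]
        · simp
      rw [Finset.sum_congr rfl fun Q _ => hstep Q]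
      by_cases h : σ = τ
      · simp only [h, if_true]
        rw [trajectorySum_succ]
        push_cast
        exact Finset.sum_congr rfl fun Q _ => by split_ifs <;> simp [t]
      · simp [h]
    · have h : σ ≠ τ := fun h => hr (by rw [h])
      simp [hr, h]

end Circuit

end PauliPath

/-! ### Path sets as disjoint families of trajectories -/

namespace PauliPath

section Combinatorics

variable {N M : ℕ}

/-- A family of strings is a trajectory if each block is active exactly when it receives a
non-identity Pauli from a later block or from the observable, and everything that reaches the
initial state is `I` or `Z`. -/
lemma isPauliTrajectory_of_forall {s : Fin M → Finset (Fin N)} {σ : Fin N → Pauli}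
    {Q : (k : Fin M) → s k → Pauli}
    (hact : ∀ k, Q k ≠ idString ↔
      (∃ k', k < k' ∧ ∃ q, ∃ hq : q ∈ s k', q ∈ s k ∧
        (∀ k'', k < k'' → k'' < k' → q ∉ s k'') ∧ Q k' ⟨q, hq⟩ ≠ .I) ∨
      ∃ q ∈ s k, (∀ k', k < k' → q ∉ s k') ∧ σ q ≠ .I)
    (hfin : ∀ k q, ∀ hq : q ∈ s k, (∀ k' < k, q ∉ s k') → Q k ⟨q, hq⟩ = .I ∨ Q k ⟨q, hq⟩ = .Z)
    (hfree : ∀ q, (∀ k, q ∉ s k) → σ q = .I ∨ σ q = .Z) : IsPauliTrajectory s σ Q := by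
  induction M generalizing σ with
  | zero => exact fun q => hfree q fun k => k.elim0
  | succ M ih =>
    refine ⟨?_, ih (fun k => ?_) (fun k q hq hk => ?_) fun q hq => ?_⟩
    · rw [← not_iff_not, ← Ne, hact]
      constructor
      · rintro (⟨k', hk', -⟩ | ⟨q, hq, -, hσ⟩)
        · exact absurd hk' (Fin.le_last k').not_gt
        · exact fun e => hσ (congrFun e ⟨q, hq⟩)
      · intro h
        obtain ⟨q, hq⟩ := exists_ne_of_ne_idString h
        exact Or.inr ⟨q, q.2, fun k' hk' => absurd hk' (Fin.le_last k').not_gt, hq⟩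
    · rw [hact]
      constructor
      · rintro (⟨k', hk', q, hq, hqk, hbet, hQ⟩ | ⟨q, hqk, hlast, hσ⟩)
        · induction k' using Fin.lastCases with
          | last =>
            refine Or.inr ⟨q, hqk, fun k'' hk'' => hbet _ (Fin.castSucc_lt_castSucc_iff.mpr hk'')
              (Fin.castSucc_lt_last _), ?_⟩
            rwa [replaceString, dif_pos hq]
          | cast k' =>
            exact Or.inl ⟨k', Fin.castSucc_lt_castSucc_iff.mp hk', q, hq, hqk, fun k'' h1 h2 =>
              hbet _ (Fin.castSucc_lt_castSucc_iff.mpr h1) (Fin.castSucc_lt_castSucc_iff.mpr h2),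
              hQ⟩
        · refine Or.inr ⟨q, hqk, fun k'' hk'' => hlast _ (Fin.castSucc_lt_castSucc_iff.mpr hk''),
            ?_⟩
          rwa [replaceString, dif_neg (hlast _ (Fin.castSucc_lt_last k))]
      · rintro (⟨k', hk', q, hq, hqk, hbet, hQ⟩ | ⟨q, hqk, hlater, hσ⟩)
        · refine Or.inl ⟨k'.castSucc, Fin.castSucc_lt_castSucc_iff.mpr hk', q, hq, hqk,
            fun k'' h1 h2 => ?_, hQ⟩
          induction k'' using Fin.lastCases with
          | last => exact absurd h2 (Fin.le_last _).not_gt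
          | cast k'' =>
            exact hbet _ (Fin.castSucc_lt_castSucc_iff.mp h1) (Fin.castSucc_lt_castSucc_iff.mp h2)
        · by_cases hq : q ∈ s (Fin.last M)
          · rw [replaceString, dif_pos hq] at hσ
            refine Or.inl ⟨Fin.last M, Fin.castSucc_lt_last k, q, hq, hqk, fun k'' h1 h2 => ?_, hσ⟩
            induction k'' using Fin.lastCases with
            | last => exact absurd h2 (lt_irrefl _)
            | cast k'' => exact hlater _ (Fin.castSucc_lt_castSucc_iff.mp h1)
          · rw [replaceString, dif_neg hq] at hσ
            refine Or.inr ⟨q, hqk, fun k'' h1 => ?_, hσ⟩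
            induction k'' using Fin.lastCases with
            | last => exact hq
            | cast k'' => exact hlater _ (Fin.castSucc_lt_castSucc_iff.mp h1)
    · refine hfin _ q hq fun k' hk' => ?_
      induction k' using Fin.lastCases with
      | last => exact absurd hk' (Fin.le_last _).not_gt
      | cast k' => exact hk _ (Fin.castSucc_lt_castSucc_iff.mp hk')
    · by_cases hl : q ∈ s (Fin.last M)
      · rw [replaceString, dif_pos hl]
        refine hfin _ q hl fun k' hk' => ?_
        induction k' using Fin.lastCases with
        | last => exact absurd hk' (lt_irrefl _)
        | cast k' => exact hq k'
      · rw [replaceString, dif_neg hl]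
        refine hfree q fun k => ?_
        induction k using Fin.lastCases with
        | last => exact hl
        | cast k => exact hq k

section Supports

variable {s : Fin M → Finset (Fin N)} {q : Fin N} {k : Fin M}

lemma mem_connSupport_bot : q ∈ connSupport s ⊥ k ↔ q ∈ s k ∧ ∀ k' < k, q ∉ s k' := by
  change q ∈ forwardResidual s k ↔ _
  simp [forwardResidual]

lemma mem_connSupport_coe {k' : Fin M} : q ∈ connSupport s (k' : WithBot (Fin M)) k ↔
    q ∈ s k' ∧ q ∈ s k ∧ ∀ k'', k' < k'' → k'' < k → q ∉ s k'' := by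
  change q ∈ (s k' ∩ s k) \ (Finset.Ioo k' k).biUnion s ↔ _
  simp [and_assoc]

lemma mem_obsConnSupport {A : Finset (Fin N)} :
    q ∈ obsConnSupport s A k ↔ q ∈ s k ∧ q ∈ A ∧ ∀ k', k < k' → q ∉ s k' := by
  simp [obsConnSupport, and_assoc]

lemma connSupport_subset (a : WithBot (Fin M)) : connSupport s a k ⊆ s k := by
  intro q hq
  induction a using WithBot.recBotCoe with
  | bot => exact (mem_connSupport_bot.mp hq).1
  | coe a => exact (mem_connSupport_coe.mp hq).2.1

/-- A qubit of `B_k` determines the object before `B_k` to which it connects `B_k`. -/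
lemma eq_of_mem_connSupport {a a' : WithBot (Fin M)} (ha : a < k) (ha' : a' < k)
    (hq : q ∈ connSupport s a k) (hq' : q ∈ connSupport s a' k) : a = a' := by
  induction a using WithBot.recBotCoe with
  | bot =>
    induction a' using WithBot.recBotCoe with
    | bot => rfl
    | coe a' =>
      exact absurd (mem_connSupport_coe.mp hq').1
        ((mem_connSupport_bot.mp hq).2 a' (WithBot.coe_lt_coe.mp ha'))
  | coe a =>
    induction a' using WithBot.recBotCoe with
    | bot =>
      exact absurd (mem_connSupport_coe.mp hq).1
        ((mem_connSupport_bot.mp hq').2 a (WithBot.coe_lt_coe.mp ha))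
    | coe a' =>
      rw [mem_connSupport_coe] at hq hq'
      rw [WithBot.coe_lt_coe] at ha ha'
      rcases lt_trichotomy a a' with h | h | h
      · exact absurd hq'.1 (hq.2.2 a' h ha')
      · rw [h]
      · exact absurd hq.1 (hq'.2.2 a h ha)

end Supports

lemma prevIn_lt (p : Finset (Fin M)) (k : Fin M) : prevIn p k < k := by
  cases h : prevIn p k with
  | bot => exact WithBot.bot_lt_coe k
  | coe a => exact WithBot.coe_lt_coe.mpr (Finset.mem_filter.mp (Finset.mem_of_max h)).2

lemma mem_of_prevIn_eq_coe {p : Finset (Fin M)} {k a : Fin M} (h : prevIn p k = a) : a ∈ p :=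
  (Finset.mem_filter.mp (Finset.mem_of_max h)).1

lemma coe_le_prevIn {p : Finset (Fin M)} {j k : Fin M} (hj : j ∈ p) (hjk : j < k) :
    (j : WithBot (Fin M)) ≤ prevIn p k :=
  Finset.le_max (Finset.mem_filter.mpr ⟨hj, hjk⟩)

lemma mem_pathSetEdges {P : Finset (Finset (Fin M))} {a : WithBot (Fin M)} {k : Fin M} :
    (a, k) ∈ pathSetEdges P ↔ ∃ p ∈ P, k ∈ p ∧ prevIn p k = a := by
  simp only [pathSetEdges, pathEdges, Finset.mem_biUnion, Finset.mem_image, Prod.mk.injEq]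
  constructor
  · rintro ⟨p, hp, k', hk', h, rfl⟩
    exact ⟨p, hp, hk', h⟩
  · rintro ⟨p, hp, hk, h⟩
    exact ⟨p, hp, k, hk, h, rfl⟩

lemma lt_of_mem_pathSetEdges {P : Finset (Finset (Fin M))} {a : WithBot (Fin M)} {k : Fin M}
    (h : (a, k) ∈ pathSetEdges P) : a < k := by
  obtain ⟨p, -, -, rfl⟩ := mem_pathSetEdges.mp h
  exact prevIn_lt p k

/-- Paths of a path set merge but do not split in the backward direction. -/
lemma pathSetEdges_unique {s : Fin M → Finset (Fin N)} {A : Finset (Fin N)}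
    {P : Finset (Finset (Fin M))} (hP : IsPathSet s A P) {a a' : WithBot (Fin M)} {k : Fin M}
    (h : (a, k) ∈ pathSetEdges P) (h' : (a', k) ∈ pathSetEdges P) : a = a' := by
  obtain ⟨p, hp, hk, rfl⟩ := mem_pathSetEdges.mp h
  obtain ⟨p', hp', hk', rfl⟩ := mem_pathSetEdges.mp h'
  have hpp := hP.2.2 p hp p' hp' k hk hk'
  have hf : ∀ r : Finset (Fin M), r.filter (· < k) = (r.filter (· ≤ k)).filter (· < k) := by
    intro r
    ext j
    simp only [Finset.mem_filter]
    exact ⟨fun h => ⟨⟨h.1, h.2.le⟩, h.2⟩, fun h => ⟨h.1.1, h.2⟩⟩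
  rw [prevIn, prevIn, hf p, hf p', hpp]

lemma connSupport_nonempty_of_mem_pathSetEdges {s : Fin M → Finset (Fin N)} {A : Finset (Fin N)}
    {P : Finset (Finset (Fin M))} (hP : IsPathSet s A P) {a : WithBot (Fin M)} {k : Fin M}
    (h : (a, k) ∈ pathSetEdges P) : (connSupport s a k).Nonempty := by
  obtain ⟨p, hp, hk, rfl⟩ := mem_pathSetEdges.mp h
  exact (hP.1 p hp).1 (prevIn p k, k) (Finset.mem_image_of_mem _ hk)

open Classical in
/-- The strings that block `k` may leave behind in the trajectories assigned to a path set: the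
identity if `k` is on no path, and otherwise a non-identity string inside the connection to the
previous object on the paths, made of `Z`s if this object is the initial state. -/
noncomputable def compatibleStrings (s : Fin M → Finset (Fin N)) (P : Finset (Finset (Fin M)))
    (k : Fin M) : Finset (s k → Pauli) :=
  Finset.univ.filter fun Q =>
    (Q ≠ idString → ∃ a, (a, k) ∈ pathSetEdges P) ∧
    ∀ a, (a, k) ∈ pathSetEdges P → Q ≠ idString ∧
      ∀ q, Q q ≠ .I → (q : Fin N) ∈ connSupport s a k ∧ (a = ⊥ → Q q = .Z)

lemma mem_compatibleStrings {s : Fin M → Finset (Fin N)} {P : Finset (Finset (Fin M))}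
    {k : Fin M} {Q : s k → Pauli} : Q ∈ compatibleStrings s P k ↔
      (Q ≠ idString → ∃ a, (a, k) ∈ pathSetEdges P) ∧
      ∀ a, (a, k) ∈ pathSetEdges P → Q ≠ idString ∧
        ∀ q, Q q ≠ .I → (q : Fin N) ∈ connSupport s a k ∧ (a = ⊥ → Q q = .Z) := by
  simp [compatibleStrings]

lemma exists_prevIn_eq_of_not_isRightEnd {p : Finset (Fin M)} {k : Fin M} (hk : k ∈ p)
    (h : ¬IsRightEnd p k) : ∃ k' ∈ p, k < k' ∧ prevIn p k' = k := by
  have hne : (p.filter (k < ·)).Nonempty := by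
    by_contra hc
    rw [Finset.not_nonempty_iff_eq_empty, Finset.filter_eq_empty_iff] at hc
    exact h ⟨hk, fun j hj => not_lt.mp (hc hj)⟩
  obtain ⟨hk'p, hkk'⟩ := Finset.mem_filter.mp (Finset.min'_mem _ hne)
  refine ⟨_, hk'p, hkk', le_antisymm (Finset.sup_le fun j hj => ?_) (coe_le_prevIn hk hkk')⟩
  obtain ⟨hjp, hj⟩ := Finset.mem_filter.mp hj
  refine WithBot.coe_le_coe.mpr (not_lt.mp fun hkj => ?_)
  exact absurd (Finset.min'_le _ j (Finset.mem_filter.mpr ⟨hjp, hkj⟩)) hj.not_ge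

/-- Every choice of compatible strings for a path set covering `σ` is a trajectory of `σ`. -/
lemma isPauliTrajectory_of_compatible {s : Fin M → Finset (Fin N)} {A : Finset (Fin N)}
    {σ : Fin N → Pauli} (hA : ∀ q, q ∈ A ↔ σ q ≠ .I) {P : Finset (Finset (Fin M))}
    (hP : IsPathSet s A P) {Q : (k : Fin M) → s k → Pauli}
    (hQ : ∀ k, Q k ∈ compatibleStrings s P k) : IsPauliTrajectory s σ Q := by
  simp only [mem_compatibleStrings] at hQ
  refine isPauliTrajectory_of_forall (fun k => ⟨fun hk => ?_, ?_⟩) (fun k q hq hk => ?_)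
    fun q hq => ?_
  · obtain ⟨a, ha⟩ := (hQ k).1 hk
    obtain ⟨p, hp, hkp, -⟩ := mem_pathSetEdges.mp ha
    by_cases hr : IsRightEnd p k
    · obtain ⟨t, ht, q, hq⟩ := (hP.1 p hp).2
      obtain rfl : t = k := le_antisymm (hr.2 t ht.1) (ht.2 k hkp)
      rw [mem_obsConnSupport] at hq
      exact Or.inr ⟨q, hq.1, hq.2.2, (hA q).mp hq.2.1⟩
    · obtain ⟨k', hk'p, hkk', hprev⟩ := exists_prevIn_eq_of_not_isRightEnd hkp hr
      obtain ⟨hne, hsub⟩ := (hQ k').2 k (mem_pathSetEdges.mpr ⟨p, hp, hk'p, hprev⟩)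
      obtain ⟨q, hq⟩ := exists_ne_of_ne_idString hne
      have hc := mem_connSupport_coe.mp (hsub q hq).1
      exact Or.inl ⟨k', hkk', q, q.2, hc.1, hc.2.2, hq⟩
  · rintro (⟨k', hkk', q, hq', hqk, hbet, hne⟩ | ⟨q, hqk, hlater, hσ⟩)
    · obtain ⟨a, ha⟩ := (hQ k').1 fun e => hne (congrFun e _)
      obtain ⟨-, hsub⟩ := (hQ k').2 a ha
      have hak : a = k := eq_of_mem_connSupport (lt_of_mem_pathSetEdges ha)
        (WithBot.coe_lt_coe.mpr hkk') (hsub _ hne).1 (mem_connSupport_coe.mpr ⟨hqk, hq', hbet⟩)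
      subst hak
      obtain ⟨p, hp, -, hprev⟩ := mem_pathSetEdges.mp ha
      exact ((hQ k).2 _ (mem_pathSetEdges.mpr ⟨p, hp, mem_of_prevIn_eq_coe hprev, rfl⟩)).1
    · obtain ⟨p, hp, t, ht, hqt⟩ := hP.2.1 q ((hA q).mpr hσ)
      rw [mem_obsConnSupport] at hqt
      have htk : t = k := by
        rcases lt_trichotomy t k with h | h | h
        · exact absurd hqk (hqt.2.2 k h)
        · exact h
        · exact absurd hqt.1 (hlater t h)
      subst htk
      exact ((hQ t).2 _ (mem_pathSetEdges.mpr ⟨p, hp, ht.1, rfl⟩)).1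
  · by_cases hI : Q k ⟨q, hq⟩ = .I
    · exact Or.inl hI
    · obtain ⟨a, ha⟩ := (hQ k).1 fun e => hI (congrFun e _)
      obtain ⟨hc, hZ⟩ := ((hQ k).2 a ha).2 _ hI
      exact Or.inr (hZ (eq_of_mem_connSupport (lt_of_mem_pathSetEdges ha) (WithBot.bot_lt_coe k) hc
        (mem_connSupport_bot.mpr ⟨hq, hk⟩)))
  · by_contra hσ
    obtain ⟨p, -, t, -, hqt⟩ := hP.2.1 q ((hA q).mpr fun h => hσ (Or.inl h))
    exact hq t (mem_obsConnSupport.mp hqt).1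

/-- Two paths with the same predecessors at their common blocks coincide back from any common
block. -/
lemma mem_iff_mem_of_prevIn_eq {p p' : Finset (Fin M)}
    (h : ∀ k, k ∈ p → k ∈ p' → prevIn p k = prevIn p' k) {k : Fin M} (hk : k ∈ p) (hk' : k ∈ p')
    {j : Fin M} (hj : j ≤ k) : j ∈ p ↔ j ∈ p' := by
  induction k using WellFoundedLT.induction with
  | ind k ih =>
    rcases hj.eq_or_lt with rfl | hj
    · exact iff_of_true hk hk'
    have hkk := h k hk hk'
    cases hprev : prevIn p k with
    | bot =>
      refine iff_of_false (fun hjp => ?_) fun hjp => ?_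
      · have := coe_le_prevIn hjp hj
        simp [hprev] at this
      · have := coe_le_prevIn hjp hj
        simp [← hkk, hprev] at this
    | coe a =>
      have ha := ih a (WithBot.coe_lt_coe.mp (hprev ▸ prevIn_lt p k))
        (mem_of_prevIn_eq_coe hprev) (mem_of_prevIn_eq_coe (hkk ▸ hprev))
      refine ⟨fun hjp => (ha ?_).mp hjp, fun hjp => (ha ?_).mpr hjp⟩
      · exact WithBot.coe_le_coe.mp (hprev ▸ coe_le_prevIn hjp hj)
      · exact WithBot.coe_le_coe.mp (hprev ▸ hkk ▸ coe_le_prevIn hjp hj)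

/-- The strings left by the blocks determine the path set. -/
lemma subset_of_compatible {s : Fin M → Finset (Fin N)} {A : Finset (Fin N)}
    {P P' : Finset (Finset (Fin M))} (hP : IsPathSet s A P) (hP' : IsPathSet s A P')
    {Q : (k : Fin M) → s k → Pauli} (hQ : ∀ k, Q k ∈ compatibleStrings s P k)
    (hQ' : ∀ k, Q k ∈ compatibleStrings s P' k) : P ⊆ P' := by
  simp only [mem_compatibleStrings] at hQ hQ'
  intro p hp
  obtain ⟨t, ht, q, hq⟩ := (hP.1 p hp).2
  rw [mem_obsConnSupport] at hq
  obtain ⟨p', hp', t', ht', hq'⟩ := hP'.2.1 q hq.2.1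
  rw [mem_obsConnSupport] at hq'
  -- The right end that covers `q` is the last block acting on `q`, in either path set.
  have htt : t = t' := by
    rcases lt_trichotomy t t' with h | h | h
    · exact absurd hq'.1 (hq.2.2 t' h)
    · exact h
    · exact absurd hq.1 (hq'.2.2 t h)
  subst htt
  have hprev : ∀ k, k ∈ p → k ∈ p' → prevIn p k = prevIn p' k := by
    intro k hk hk'
    obtain ⟨hne, hsub⟩ := (hQ k).2 _ (mem_pathSetEdges.mpr ⟨p, hp, hk, rfl⟩)
    obtain ⟨-, hsub'⟩ := (hQ' k).2 _ (mem_pathSetEdges.mpr ⟨p', hp', hk', rfl⟩)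
    obtain ⟨r, hr⟩ := exists_ne_of_ne_idString hne
    exact eq_of_mem_connSupport (prevIn_lt p k) (prevIn_lt p' k) (hsub r hr).1 (hsub' r hr).1
  have hpp : p = p' := by
    ext j
    constructor
    · exact fun hj => (mem_iff_mem_of_prevIn_eq hprev ht.1 ht'.1 (ht.2 j hj)).mp hj
    · exact fun hj => (mem_iff_mem_of_prevIn_eq hprev ht.1 ht'.1 (ht'.2 j hj)).mpr hj
  rwa [hpp]

/-- The number of strings on `s` with letters from `T` that are the identity off `c ⊆ s`. -/
lemma card_piFinset_ite {s c : Finset (Fin N)} (hc : c ⊆ s) (T : Finset Pauli) :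
    (Fintype.piFinset fun q : s => if (q : Fin N) ∈ c then T else {.I}).card =
      T.card ^ c.card := by
  rw [Fintype.card_piFinset, Finset.prod_coe_sort s fun q =>
    (if q ∈ c then T else {.I} : Finset Pauli).card]
  simp only [apply_ite Finset.card, Finset.card_singleton]
  rw [Finset.prod_ite_mem, Finset.inter_eq_right.mpr hc, Finset.prod_const]

/-- The factor of an edge `(a, B_k)` in `2 ^ (-2 l(P) - w(P))`. -/
noncomputable def edgeFactor (s : Fin M → Finset (Fin N)) (e : WithBot (Fin M) × Fin M) : ℝ :=
  ((4 : ℝ) ^ (connSupport s e.1 e.2).card - 1) / ((4 : ℝ) ^ (s e.2).card - 1) *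
    if e.1 = ⊥ then ((2 : ℝ) ^ (forwardResidual s e.2).card - 1) /
      ((4 : ℝ) ^ (forwardResidual s e.2).card - 1) else 1

lemma pow_sub_one_pos {b : ℝ} (hb : 1 < b) {c : Finset (Fin N)} (hc : c.Nonempty) :
    0 < b ^ c.card - 1 :=
  sub_pos.mpr (one_lt_pow₀ hb hc.card_pos.ne')

lemma rpow_eq_prod_edgeFactor {s : Fin M → Finset (Fin N)} {A : Finset (Fin N)}
    {P : Finset (Finset (Fin M))} (hP : IsPathSet s A P) :
    (2 : ℝ) ^ (-2 * pathSetLength s P - headWidth s P) = ∏ e ∈ pathSetEdges P, edgeFactor s e := by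
  have h4 : ∀ x : ℝ, 0 < x → (2 : ℝ) ^ (-2 * Real.logb 4 x) = x⁻¹ := by
    intro x hx
    rw [show -2 * Real.logb 4 x = (2 : ℝ) * (-Real.logb 4 x) by ring,
      Real.rpow_mul zero_le_two, show (2 : ℝ) ^ (2 : ℝ) = 4 by norm_num,
      Real.rpow_neg (by norm_num), Real.rpow_logb (by norm_num) (by norm_num) hx]
  have h2 : ∀ x : ℝ, 0 < x → (2 : ℝ) ^ (-Real.logb 2 x) = x⁻¹ := by
    intro x hx
    rw [Real.rpow_neg (by norm_num), Real.rpow_logb (by norm_num) (by norm_num) hx]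
  have hhead : ∏ k ∈ headBlocks P, (2 : ℝ) ^ (-blockWidth s k) =
      ∏ e ∈ pathSetEdges P, if e.1 = ⊥ then (2 : ℝ) ^ (-blockWidth s e.2) else 1 := by
    rw [← Finset.prod_filter]
    refine Finset.prod_bij' (fun k _ => (⊥, k)) (fun e _ => e.2) ?_ ?_ ?_ ?_ ?_
    · intro k hk
      exact Finset.mem_filter.mpr ⟨(Finset.mem_filter.mp hk).2, rfl⟩
    · rintro ⟨a, k⟩ he
      obtain ⟨he, rfl⟩ := Finset.mem_filter.mp he
      exact Finset.mem_filter.mpr ⟨Finset.mem_univ _, he⟩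
    · intro k _
      rfl
    · rintro ⟨a, k⟩ he
      obtain ⟨-, rfl⟩ := Finset.mem_filter.mp he
      rfl
    · intro k _
      rfl
  rw [sub_eq_add_neg, Real.rpow_add zero_lt_two, pathSetLength, headWidth, Finset.mul_sum,
    ← Finset.sum_neg_distrib, Real.rpow_sum_of_pos zero_lt_two, Real.rpow_sum_of_pos zero_lt_two,
    hhead, ← Finset.prod_mul_distrib]
  refine Finset.prod_congr rfl fun e he => ?_
  obtain ⟨a, k⟩ := e
  have hc := connSupport_nonempty_of_mem_pathSetEdges hP he
  have hs : (s k).Nonempty := hc.mono (connSupport_subset a)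
  rw [edgeLength, edgeFactor, h4 _ (div_pos (pow_sub_one_pos (by norm_num) hs)
    (pow_sub_one_pos (by norm_num) hc)), inv_div]
  congr 1
  split_ifs with ha
  · obtain rfl : a = ⊥ := ha
    have hf : (forwardResidual s k).Nonempty := hc
    rw [blockWidth, h2 _ (div_pos (pow_sub_one_pos (by norm_num) hf)
      (pow_sub_one_pos (by norm_num) hf)), inv_div]
  · rfl

/-- The compatible strings of a block with an edge have at least the weight of that edge. -/
lemma edgeFactor_le_sum {s : Fin M → Finset (Fin N)} {A : Finset (Fin N)}
    {P : Finset (Finset (Fin M))} (hP : IsPathSet s A P) {a : WithBot (Fin M)} {k : Fin M}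
    (h : (a, k) ∈ pathSetEdges P) :
    edgeFactor s (a, k) ≤ ∑ Q ∈ compatibleStrings s P k, pauliWeight Q := by
  have hc := connSupport_nonempty_of_mem_pathSetEdges hP h
  have hs : (s k).Nonempty := hc.mono (connSupport_subset a)
  have hpos : 0 < (4 : ℝ) ^ (s k).card - 1 := pow_sub_one_pos (by norm_num) hs
  set T : Finset Pauli := if a = ⊥ then {.I, .Z} else Finset.univ with hT
  have hIT : Pauli.I ∈ T := by
    rw [hT]
    split_ifs <;> simp
  set S := (Fintype.piFinset fun q : s k =>
    if (q : Fin N) ∈ connSupport s a k then T else {.I}).erase idString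
  have hsub : S ⊆ compatibleStrings s P k := by
    intro Q hQ
    obtain ⟨hne, hQ⟩ := Finset.mem_erase.mp hQ
    rw [Fintype.mem_piFinset] at hQ
    refine mem_compatibleStrings.mpr ⟨fun _ => ⟨a, h⟩, fun a' ha' => ⟨hne, fun q hq => ?_⟩⟩
    obtain rfl := pathSetEdges_unique hP h ha'
    have hQq := hQ q
    split_ifs at hQq with hqc
    · refine ⟨hqc, fun hbot => ?_⟩
      rw [hT, if_pos hbot] at hQq
      simpa [hq] using hQq
    · exact absurd (Finset.mem_singleton.mp hQq) hq
  have hcard : (S.card : ℝ) = (T.card : ℝ) ^ (connSupport s a k).card - 1 := by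
    rw [Finset.card_erase_of_mem, card_piFinset_ite (connSupport_subset a), Nat.cast_sub]
    · push_cast
      rfl
    · exact Nat.one_le_pow _ _ (Finset.card_pos.mpr ⟨_, hIT⟩)
    · refine Fintype.mem_piFinset.mpr fun q => ?_
      split_ifs
      · exact hIT
      · exact Finset.mem_singleton_self _
  have hsum : ∑ Q ∈ S, pauliWeight Q = ((T.card : ℝ) ^ (connSupport s a k).card - 1) /
      ((4 : ℝ) ^ (s k).card - 1) := by
    rw [Finset.sum_congr rfl fun Q hQ => show pauliWeight Q = ((4 : ℝ) ^ (s k).card - 1)⁻¹ by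
      rw [pauliWeight, if_neg (Finset.ne_of_mem_erase hQ), Fintype.card_coe],
      Finset.sum_const, nsmul_eq_mul, hcard, div_eq_mul_inv]
  refine le_trans (le_of_eq ?_) (Finset.sum_le_sum_of_subset_of_nonneg hsub
    fun Q _ _ => pauliWeight_nonneg Q)
  rw [hsum, edgeFactor]
  by_cases ha : a = ⊥
  · subst ha
    have hf : 0 < (4 : ℝ) ^ (forwardResidual s k).card - 1 := pow_sub_one_pos (by norm_num) hc
    have hT2 : T.card = 2 := by rw [hT, if_pos rfl]; rfl
    change ((4 : ℝ) ^ (forwardResidual s k).card - 1) / _ * (if (⊥ : WithBot (Fin M)) = ⊥ then _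
      else _) = ((T.card : ℝ) ^ (forwardResidual s k).card - 1) / _
    rw [if_pos rfl, hT2]
    field_simp
    norm_num
  · have hT4 : T.card = 4 := by rw [hT, if_neg ha]; rfl
    simp only [ha, if_false, mul_one, hT4]
    norm_num

/-- The weight of a path set is at most the total weight of the trajectories assigned to it. -/
lemma rpow_le_sum_compatible {s : Fin M → Finset (Fin N)} {A : Finset (Fin N)}
    {P : Finset (Finset (Fin M))} (hP : IsPathSet s A P) :
    (2 : ℝ) ^ (-2 * pathSetLength s P - headWidth s P) ≤
      ∑ Q ∈ Fintype.piFinset (compatibleStrings s P), ∏ k, pauliWeight (Q k) := by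
  rw [rpow_eq_prod_edgeFactor hP, ← Finset.prod_univ_sum]
  -- Each block has at most one incoming edge, so the edges are indexed by their blocks.
  have hinj : Set.InjOn Prod.snd (pathSetEdges P : Set (WithBot (Fin M) × Fin M)) := by
    rintro ⟨a, k⟩ h ⟨a', k'⟩ h' hkk
    obtain rfl : k = k' := hkk
    rw [pathSetEdges_unique hP h h']
  rw [← Finset.prod_subset (Finset.subset_univ ((pathSetEdges P).image Prod.snd)),
    Finset.prod_image hinj]
  · refine Finset.prod_le_prod (fun e he => ?_) fun e he => edgeFactor_le_sum hP he
    obtain ⟨a, k⟩ := e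
    have hc := connSupport_nonempty_of_mem_pathSetEdges hP he
    have hs : (s k).Nonempty := hc.mono (connSupport_subset a)
    refine mul_nonneg (div_nonneg (pow_sub_one_pos (by norm_num) hc).le
      (pow_sub_one_pos (by norm_num) hs).le) ?_
    split_ifs with ha
    · obtain rfl : a = ⊥ := ha
      have hf : (forwardResidual s k).Nonempty := hc
      exact div_nonneg (pow_sub_one_pos (by norm_num) hf).le (pow_sub_one_pos (by norm_num) hf).le
    · exact zero_le_one
  · intro k _ hk
    have hno : ∀ a, (a, k) ∉ pathSetEdges P := fun a ha => hk (Finset.mem_image_of_mem Prod.snd ha)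
    have : compatibleStrings s P k = {idString} := by
      ext Q
      simp [mem_compatibleStrings, hno]
    rw [this, Finset.sum_singleton, pauliWeight, if_pos rfl]

/-- The sum of the path set weights is at most the sum over all trajectories. -/
theorem sum_pathSets_le_trajectorySum (s : Fin M → Finset (Fin N)) {A : Finset (Fin N)}
    {σ : Fin N → Pauli} (hA : ∀ q, q ∈ A ↔ σ q ≠ .I) :
    ∑ P ∈ pathSets s A, (2 : ℝ) ^ (-2 * pathSetLength s P - headWidth s P) ≤
      trajectorySum s σ := by
  classical
  have hmem : ∀ P ∈ pathSets s A, IsPathSet s A P := fun P hP => by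
    simpa [pathSets] using hP
  refine (Finset.sum_le_sum fun P hP => rpow_le_sum_compatible (hmem P hP)).trans ?_
  rw [← Finset.sum_biUnion]
  · rw [trajectorySum, ← Finset.sum_filter]
    refine Finset.sum_le_sum_of_subset_of_nonneg ?_ fun Q _ _ =>
      Finset.prod_nonneg fun k _ => pauliWeight_nonneg _
    intro Q hQ
    obtain ⟨P, hP, hQ⟩ := Finset.mem_biUnion.mp hQ
    exact Finset.mem_filter.mpr ⟨Finset.mem_univ _,
      isPauliTrajectory_of_compatible hA (hmem P hP) (Fintype.mem_piFinset.mp hQ)⟩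
  · intro P hP P' hP' hne
    refine Finset.disjoint_left.mpr fun Q hQ hQ' => hne ?_
    rw [Fintype.mem_piFinset] at hQ hQ'
    exact (subset_of_compatible (hmem P hP) (hmem P' hP') hQ hQ').antisymm
      (subset_of_compatible (hmem P' hP') (hmem P hP) hQ' hQ)

end Combinatorics

end PauliPath

/-! ### Supports of observables and the variance of the cost -/

namespace PauliPath

section Variance

variable {N M : ℕ}

lemma mem_opSupport {O : Matrix (Fin N → Fin 2) (Fin N → Fin 2) ℂ} {q : Fin N} :
    q ∈ opSupport O ↔ O ∉ Set.range (liftOp (Finset.univ.erase q)) := by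
  simp [opSupport]

lemma trace_pauliOp_mul_pauliOp (σ τ : Fin N → Pauli) :
    (pauliOp σ * pauliOp τ).trace = if σ = τ then 2 ^ N else 0 := by
  have h := trace_pauliMat_mul σ τ
  rwa [Fintype.card_fin] at h

lemma trace_liftOp_mul_pauliOp {s : Finset (Fin N)} (A : Matrix (s → Fin 2) (s → Fin 2) ℂ)
    {σ : Fin N → Pauli} {q : Fin N} (hq : q ∉ s) (hσ : σ q ≠ .I) :
    (liftOp s A * pauliOp σ).trace = 0 := by
  rw [liftOp_eq_submatrix, pauliOp_eq_submatrix s, Matrix.submatrix_mul_equiv,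
    ← Matrix.mul_kronecker_mul, one_mul]
  have h0 : (pauliMat fun q : {q // q ∉ s} => σ q).trace = 0 := by
    rw [trace_pauliMat, if_neg fun e => hσ (congrFun e ⟨q, hq⟩)]
  rw [Matrix.trace, ← (splitEquiv s).symm.sum_comp]
  simp only [Matrix.diag, Matrix.submatrix_apply, Equiv.apply_symm_apply]
  exact (Matrix.trace_kronecker _ _).trans (by rw [h0, mul_zero])

/-- A Pauli string that occurs in `O` is supported on the support of `O`. -/
lemma mem_opSupport_of_trace_ne_zero {O : Matrix (Fin N → Fin 2) (Fin N → Fin 2) ℂ}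
    {σ : Fin N → Pauli} {q : Fin N} (hO : (O * pauliOp σ).trace ≠ 0) (hσ : σ q ≠ .I) :
    q ∈ opSupport O := by
  rw [mem_opSupport]
  rintro ⟨A, rfl⟩
  exact hO (trace_liftOp_mul_pauliOp A (Finset.notMem_erase q _) hσ)

lemma mem_opSupport_pauliOp (σ : Fin N → Pauli) (q : Fin N) :
    q ∈ opSupport (pauliOp σ) ↔ σ q ≠ .I := by
  refine ⟨fun h hq => mem_opSupport.mp h ?_, fun h => mem_opSupport_of_trace_ne_zero ?_ h⟩
  · refine ⟨pauliMat (restrictString (Finset.univ.erase q) σ), ?_⟩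
    have h1 : (fun r : {r // r ∉ Finset.univ.erase q} => σ r) = idString := by
      ext1 ⟨r, hr⟩
      obtain rfl : r = q := by simpa using hr
      exact hq
    rw [liftOp_eq_submatrix, pauliOp_eq_submatrix (Finset.univ.erase q), h1, pauliMat_idString]
  · rw [trace_pauliOp_mul_pauliOp, if_pos rfl]
    exact pow_ne_zero _ two_ne_zero

lemma energyCost_eq (H U : Matrix (Fin N → Fin 2) (Fin N → Fin 2) ℂ) :
    energyCost H U = ((star U * H * U) 0 0).re := by
  simp only [energyCost, Matrix.mulVec_single_one]
  rw [mul_assoc]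
  rfl

lemma ofReal_energyCost {ι : Type*} [Fintype ι] (h : ι → Fin N → Pauli) (lam : ι → ℝ)
    (s : Fin M → Finset (Fin N)) (B : (k : Fin M) → Matrix.unitaryGroup (s k → Fin 2) ℂ) :
    (energyCost (∑ j, (lam j : ℂ) • pauliOp (h j)) (circuitUnitary s B) : ℂ) =
      ∑ j, (lam j : ℂ) * pauliExpect s B (h j) := by
  have h1 : (star (circuitUnitary s B) * (∑ j, (lam j : ℂ) • pauliOp (h j)) *
      circuitUnitary s B) 0 0 = ∑ j, (lam j : ℂ) * pauliExpect s B (h j) := by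
    rw [Finset.mul_sum, Finset.sum_mul, Matrix.sum_apply]
    simp only [pauliExpect, Matrix.mul_smul, Matrix.smul_mul, Matrix.smul_apply, smul_eq_mul]
  rw [energyCost_eq, h1]
  refine Complex.conj_eq_iff_re.mp ?_
  rw [map_sum]
  refine Finset.sum_congr rfl fun j _ => ?_
  rw [map_mul, Complex.conj_ofReal]
  exact congrArg _ (star_pauliExpect s B (h j))

variable {Θ : Type*} [MeasurableSpace Θ] {μ : Measure Θ} [IsProbabilityMeasure μ]

/-- The exact variance of the cost: the mean vanishes, cross terms vanish, and each Pauli string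
contributes the sum over its trajectories. -/
theorem variance_energyCost {ι : Type*} [Fintype ι] {s : Fin M → Finset (Fin N)}
    {B : (k : Fin M) → Θ → Matrix.unitaryGroup (s k → Fin 2) ℂ}
    (hB : ∀ k, Measurable (B k)) (hindep : iIndepFun B μ)
    (hdesign : ∀ k, IsTwoDesign (μ.map (B k))) {h : ι → Fin N → Pauli}
    (hinj : Function.Injective h) {lam : ι → ℝ} (hid : ∀ j, lam j ≠ 0 → h j ≠ idString)
    (hcov : ∀ j, lam j ≠ 0 → ∀ q, h j q ≠ .I → ∃ k, q ∈ s k) :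
    Var[fun θ => energyCost (∑ j, (lam j : ℂ) • pauliOp (h j))
      (circuitUnitary s fun k => B k θ); μ] = ∑ j, lam j ^ 2 * trajectorySum s (h j) := by
  set X : Θ → ℝ := fun θ => energyCost (∑ j, (lam j : ℂ) • pauliOp (h j))
      (circuitUnitary s fun k => B k θ)
  have hX : ∀ θ, (X θ : ℂ) = ∑ j, (lam j : ℂ) * pauliExpect s (fun k => B k θ) (h j) :=
    fun θ => ofReal_energyCost h lam s _
  have hmeas : Measurable X := by
    have hre : X = fun θ => (∑ j, (lam j : ℂ) * pauliExpect s (fun k => B k θ) (h j)).re := by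
      ext θ
      rw [← hX, Complex.ofReal_re]
    rw [hre]
    exact Complex.measurable_re.comp (Finset.measurable_sum _ fun j _ =>
      ((measurable_pauliExpect s (h j)).comp (measurable_pi_lambda _ hB)).const_mul _)
  choose C hC using fun j => exists_norm_pauliExpect_le s (h j)
  have hbound : ∀ θ, ‖X θ‖ ≤ ∑ j, |lam j| * C j := by
    intro θ
    rw [← Complex.norm_real, hX]
    refine (norm_sum_le _ _).trans (Finset.sum_le_sum fun j _ => ?_)
    rw [norm_mul, Complex.norm_real]
    exact mul_le_mul_of_nonneg_left (hC j _) (abs_nonneg _)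
  have hmem : MemLp X 2 μ := MemLp.of_bound hmeas.aestronglyMeasurable _ (.of_forall hbound)
  have hmean : ∫ θ, X θ ∂μ = 0 := by
    have hterm : ∀ j, ∫ θ, (lam j : ℂ) * pauliExpect s (fun k => B k θ) (h j) ∂μ = 0 := by
      intro j
      rw [integral_const_mul]
      by_cases hj : lam j = 0
      · simp [hj]
      -- The identity string has expectation one, so the mean is a cross term with it.
      have := integral_pauliExpect_mul hB hindep hdesign (σ := h j) (τ := idString) (by
        intro hne
        obtain ⟨q, hq⟩ := exists_ne_of_ne_idString hne
        exact ⟨q, hq, hcov j hj q hq⟩)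
      simp only [pauliExpect_idString, mul_one, if_neg (hid j hj)] at this
      rw [this, mul_zero]
    have hint : ∀ j,
        Integrable (fun θ => (lam j : ℂ) * pauliExpect s (fun k => B k θ) (h j)) μ := by
      intro j
      have := integrable_pauliExpect_mul (μ := μ) hB (h j) idString
      simp only [pauliExpect_idString, mul_one] at this
      exact this.const_mul _
    have hC0 : ((∫ θ, X θ ∂μ : ℝ) : ℂ) = 0 := by
      rw [← integral_complex_ofReal]
      simp only [hX]
      rw [integral_finsetSum _ fun j _ => hint j]
      exact Finset.sum_eq_zero fun j _ => hterm j
    exact_mod_cast hC0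
  have hsq : ∫ θ, X θ ^ 2 ∂μ = ∑ j, lam j ^ 2 * trajectorySum s (h j) := by
    classical
    have hterm : ∀ i j, ∫ θ, (lam i * lam j : ℂ) * (pauliExpect s (fun k => B k θ) (h i) *
        pauliExpect s (fun k => B k θ) (h j)) ∂μ =
        if i = j then (lam i : ℂ) ^ 2 * trajectorySum s (h i) else 0 := by
      intro i j
      rw [integral_const_mul]
      by_cases hi : lam i = 0
      · simp [hi]
      by_cases hj : lam j = 0
      · by_cases hij : i = j
        · exact absurd (hij ▸ hj) hi
        · simp [hj, hij]
      rw [integral_pauliExpect_mul hB hindep hdesign]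
      · simp only [hinj.eq_iff]
        split_ifs with hij
        · rw [hij, sq]
        · rw [mul_zero]
      · intro hne
        obtain ⟨q, hq⟩ := Function.ne_iff.mp hne
        refine ⟨q, hq, ?_⟩
        by_cases hI : h i q = .I
        · exact hcov j hj q fun e => hq (hI.trans e.symm)
        · exact hcov i hi q hI
    have hexp : ∀ θ, ((X θ ^ 2 : ℝ) : ℂ) = ∑ i, ∑ j, (lam i * lam j : ℂ) *
        (pauliExpect s (fun k => B k θ) (h i) * pauliExpect s (fun k => B k θ) (h j)) := by
      intro θ
      rw [Complex.ofReal_pow, hX, sq, Finset.sum_mul_sum]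
      exact Finset.sum_congr rfl fun i _ => Finset.sum_congr rfl fun j _ =>
        mul_mul_mul_comm _ _ _ _
    have hint : ∀ i j, Integrable (fun θ => (lam i * lam j : ℂ) *
        (pauliExpect s (fun k => B k θ) (h i) * pauliExpect s (fun k => B k θ) (h j))) μ :=
      fun i j => (integrable_pauliExpect_mul hB (h i) (h j)).const_mul _
    have hC2 : ((∫ θ, X θ ^ 2 ∂μ : ℝ) : ℂ) =
        ((∑ j, lam j ^ 2 * trajectorySum s (h j) : ℝ) : ℂ) := by
      rw [← integral_complex_ofReal]
      simp only [hexp]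
      rw [integral_finsetSum _ fun i _ => integrable_finsetSum _ fun j _ => hint i j]
      push_cast
      refine Finset.sum_congr rfl fun i _ => ?_
      rw [integral_finsetSum _ fun j _ => hint i j, Finset.sum_congr rfl fun j _ => hterm i j]
      simp
    exact_mod_cast hC2
  rw [variance_eq_sub hmem, hmean]
  simpa using hsq

end Variance

end PauliPath

theorem mainTheorem2 {N M : ℕ} {ι : Type*} [Fintype ι]
    {Θ : Type*} [MeasurableSpace Θ] (μ : Measure Θ) [IsProbabilityMeasure μ]
    (s : Fin M → Finset (Fin N))
    (B : (k : Fin M) → Θ → Matrix.unitaryGroup (s k → Fin 2) ℂ)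
    (hB : ∀ k, Measurable (B k))
    (hindep : iIndepFun B μ)
    (hdesign : ∀ k, IsTwoDesign (μ.map (B k)))
    (H : Matrix (Fin N → Fin 2) (Fin N → Fin 2) ℂ)
    (h : ι → Fin N → Pauli) (hinj : Function.Injective h) (lam : ι → ℝ)
    (hH : H = ∑ j, (lam j : ℂ) • pauliOp (h j))
    (htrace : H.trace = 0)
    (hsupp : opSupport H ⊆ Finset.univ.biUnion s) :
    ∑ j, ∑ P ∈ pathSets s (opSupport (pauliOp (h j))),
        lam j ^ 2 * (2 : ℝ) ^ (-2 * pathSetLength s P - headWidth s P) ≤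
      Var[fun θ => energyCost H (circuitUnitary s fun k => B k θ); μ] := by
  have hcoeff : ∀ j, (H * pauliOp (h j)).trace = lam j * 2 ^ N := by
    intro j
    classical
    rw [hH, Finset.sum_mul, Matrix.trace_sum, Finset.sum_eq_single j]
    · rw [Matrix.smul_mul, Matrix.trace_smul, PauliPath.trace_pauliOp_mul_pauliOp, if_pos rfl,
        smul_eq_mul]
    · intro i _ hij
      rw [Matrix.smul_mul, Matrix.trace_smul, PauliPath.trace_pauliOp_mul_pauliOp,
        if_neg (hinj.ne hij), smul_zero]
    · simp
  have hne : ∀ j, lam j ≠ 0 → (H * pauliOp (h j)).trace ≠ 0 := by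
    intro j hj
    rw [hcoeff]
    exact mul_ne_zero (Complex.ofReal_ne_zero.mpr hj) (pow_ne_zero _ two_ne_zero)
  -- The coefficient of the identity string is the normalized trace.
  have hid : ∀ j, lam j ≠ 0 → h j ≠ PauliPath.idString := by
    intro j hj e
    refine hne j hj ?_
    rw [e, show pauliOp PauliPath.idString = 1 from PauliPath.pauliMat_idString, mul_one, htrace]
  have hcov : ∀ j, lam j ≠ 0 → ∀ q, h j q ≠ .I → ∃ k, q ∈ s k := by
    intro j hj q hq
    simpa using hsupp (PauliPath.mem_opSupport_of_trace_ne_zero (hne j hj) hq)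
  rw [hH, PauliPath.variance_energyCost hB hindep hdesign hinj hid hcov]
  refine Finset.sum_le_sum fun j _ => ?_
  rw [← Finset.mul_sum]
  exact mul_le_mul_of_nonneg_left
    (PauliPath.sum_pathSets_le_trajectorySum s (PauliPath.mem_opSupport_pauliOp (h j)))
    (sq_nonneg _)
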